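/- **Setting.** Let $\tau_L,\tau_R\in\mathbb R$, $\delta_L,\delta_R>0$, $A_L=\begin{bmatrix}\tau_L&1\\-\delta_L&0\end{bmatrix}$, $A_R=\begin{bmatrix}\tau_R&1\\-\delta_R&0\end{bmatrix}$, $b=(1,0)^{\sf T}$, $f_L(x)=A_Lx+b$, $f_R(x)=A_Rx+b$. The 2d border-collision normal form is the map $f:\mathbb R^2\to\mathbb R^2$ with $f(x)=f_L(x)$ if $x_1\le 0$ and $f(x)=f_R(x)$ if $x_1\ge0$. It is a bijection. Let $\Sigma=\{x : x_1=0\}$, so $f(\Sigma)=\{x : x_2=0\}$, and use the Euclidean norm. **Points.** For $\beta>0$ let $X=(0,\beta)$. Let $r$ be the smallest $i\ge1$ with $f^i(X)_1\le0$, and $\ell$ the smallest $j\ge1$ with $f^{-j}(X)_1\ge0$, if these exist. Then let $Z=f^r(X)$, let $Y$ be the intersection of the line through $Z$ and $f^{-1}(Z)$ with $\Sigma$, let $V=f^{-(\ell-1)}(X)$, and let $U$ be the intersection of the line through $V$ and $f(V)$ with $f(\Sigma)$. For $x_1\le0$ let $\chi_L(x)\in\{1,2,\dots,\infty\}$ be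 the smallest $p\ge1$ with $f_L^p(x)_1>0$ ($\infty$ if there is none), and let $p_{\max}=\max[\chi_L(Y),\chi_L(Z)]$. **Matrices.** For $j=1,\dots,p_{\max}+1$ write $M^{(j)}=A_L^{\,j-1}A_R=\begin{bmatrix}a_j&b_j\\c_j&d_j\end{bmatrix}$, $G_j(m)=\frac{c_j+d_jm}{a_j+b_jm}$ and $H_j(m)=(b_j^2+d_j^2-1)m^2+2(a_jb_j+c_jd_j)m+a_j^2+c_j^2-1$. **Algorithm** (with parameters $\beta_{\min}>0$, $\beta_{\rm step}>0$, $\beta_{\max}\in\mathbb R$, and exact real arithmetic). *Search.* Start with $\chi_{\rm chaos}=\text{false}$ and $\beta=\beta_{\min}$. While $\chi_{\rm chaos}=\text{false}$ and $\beta\le\beta_{\max}$: if (C1) and (C2) both hold for $\beta$, set $\chi_{\rm chaos}=\text{true}$; otherwise replace $\beta$ by $\beta+\beta_{\rm step}$. - (C1) Both $r$ and $\ell$ exist. - (C2) $Y$ lies above $f^{-1}(U)$ (both are on $\Sigma$), $Z$ lies above the line through $f^{-1}(U)$ and $V$, and $Z$ lies to the right of the line through $V$ and $f(V)$, all strictly.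 *Cone.* If the search ended with $\chi_{\rm chaos}=\text{true}$, evaluate $p_{\max}$ for the final $\beta$ and test (C3), (C4), (C5) in this order, resetting $\chi_{\rm chaos}=\text{false}$ at the first that fails. - (C3) $0<\det M^{(j)}<\frac14\operatorname{trace}(M^{(j)})^2$ and $b_j\neq0$ for all $j\in\{1,\dots,p_{\max}+1\}$. In this case $G_j$ has exactly one stable fixed point $m^{(j)}_{\rm stab}$ (where $|G_j'|<1$) and exactly one unstable fixed point $m^{(j)}_{\rm unstab}$ (where $|G_j'|>1$). Let $m_{\rm stab,min}$ and $m_{\rm stab,max}$ be the minimum and maximum of the $m^{(j)}_{\rm stab}$. - (C4) There is no $j$ with $m_{\rm stab,min}\le m^{(j)}_{\rm unstab}\le m_{\rm stab,max}$. - (C5) For each $j$ with $b_j^2+d_j^2\ne1$, the quadratic $H_j$ has two distinct real roots, one, $m^{(j)}_{\rm incr}$, at which it is increasing and one, $m^{(j)}_{\rm decr}$, at which it is decreasing, and at least two of the inequalities $m_{\rm stab,max}<m^{(j)}_{\rm decr}$, $m^{(j)}_{\rm decr}<m^{(j)}_{\rm incr}$, $m^{(j)}_{\rm incr}<m_{\rm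 stab,min}$ hold. For each $j$ with $b_j^2+d_j^2=1$, one has $k_j:=a_jb_j+c_jd_j\ne0$, and $m^{(j)}_{\rm root}=-\frac{a_j^2+c_j^2-1}{2k_j}$ satisfies $m^{(j)}_{\rm root}>m_{\rm stab,max}$ if $k_j<0$ and $m^{(j)}_{\rm root}<m_{\rm stab,min}$ if $k_j>0$. The algorithm outputs the final value of $\chi_{\rm chaos}$. **Theorem.** If the algorithm terminates with $\chi_{\rm chaos}=\text{true}$, then $f$ has an attractor with a positive Lyapunov exponent. That is, there is a compact set $\Omega\subset\mathbb R^2$ with $f(\Omega)\subseteq\operatorname{int}(\Omega)$ whose attracting set $\Lambda=\bigcap_{i=0}^\infty f^i(\Omega)$ is nonempty, and for every $x\in\Lambda$ there is $v\in\mathbb R^2$ such that the one-sided directional derivatives $$D^+_vf^n(x)=\lim_{\delta\to0^+}\frac{f^n(x+\delta v)-f^n(x)}{\delta}$$ exist for all $n\ge1$ and $$\lambda(x,v)=\limsup_{n\to\infty}\frac1n\ln\left\|D^+_vf^n(x)\right\|$$ is a positive (finite) real number. -/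

import Mathlib

open Filter Topology

noncomputable section

/-! ### Trapping regions, attracting sets, Lyapunov exponents -/

/-- A compact set that is mapped by `f` into its own interior. -/
def IsTrappingRegion {E : Type*} [TopologicalSpace E] (f : E → E) (Ω : Set E) : Prop :=
  IsCompact Ω ∧ f '' Ω ⊆ interior Ω

/-- An attracting set: the intersection of all forward images of a trapping region. -/
def IsAttractingSet {E : Type*} [TopologicalSpace E] (f : E → E) (Λ : Set E) : Prop :=
  ∃ Ω : Set E, IsTrappingRegion f Ω ∧ Λ = ⋂ i : ℕ, f^[i] '' Ω

/-- `d` is the one-sided directional derivative of `φ` at `x` in the direction `v`. -/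
def HasOneSidedDeriv {E : Type*} [NormedAddCommGroup E] [NormedSpace ℝ E]
    (φ : E → E) (x v d : E) : Prop :=
  Tendsto (fun t : ℝ => t⁻¹ • (φ (x + t • v) - φ x)) (𝓝[>] 0) (𝓝 d)

/-- All one-sided directional derivatives of the iterates `f^n`, `n ≥ 1`, exist at `x` in the
direction `v`, and `lam` is the upper limit of `(1/n) ln ‖D_v f^n (x)‖`. The upper limit is taken
in the extended reals, with `ln 0 = -∞`. -/
def IsLyapunovExponent {E : Type*} [NormedAddCommGroup E] [NormedSpace ℝ E]
    (f : E → E) (x v : E) (lam : EReal) : Prop :=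
  ∃ D : ℕ → E, (∀ n, 1 ≤ n → HasOneSidedDeriv (f^[n]) x v (D n)) ∧
    limsup (fun n : ℕ => ENNReal.log ‖D n‖ₑ / ((n : ℝ) : EReal)) atTop = lam

/-! ### The border-collision normal form and its inverse -/

/-- The plane with the Euclidean norm; `x 0` and `x 1` are the coordinates written `x₁` and `x₂`
in the comments below. -/
abbrev Plane := EuclideanSpace ℝ (Fin 2)

/-- The matrix `[τ, 1; -δ, 0]`. -/
def bcMatrix (τ δ : ℝ) : Matrix (Fin 2) (Fin 2) ℝ := !![τ, 1; -δ, 0]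

/-- The affine half-map `x ↦ A x + (1, 0)`. -/
def halfMap (τ δ : ℝ) (x : Plane) : Plane :=
  Matrix.toEuclideanLin (bcMatrix τ δ) x + !₂[1, 0]

/-- The four parameters of the normal form. -/
structure BCParams where
  (τL δL τR δR : ℝ)

namespace BCParams

variable (q : BCParams)

/-- The left half-map. -/
def fL : Plane → Plane := halfMap q.τL q.δL

/-- The right half-map. -/
def fR : Plane → Plane := halfMap q.τR q.δR

/-- The two-dimensional border-collision normal form. -/
def f (x : Plane) : Plane := if x 0 ≤ 0 then q.fL x else q.fR x

/-- The inverse of `f` when `δL, δR > 0`; see `f_fInv` and `fInv_f`. -/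
def fInv (y : Plane) : Plane :=
  if 0 ≤ y 1 then !₂[-(y 1 / q.δL), y 0 - 1 + q.τL * (y 1 / q.δL)]
  else !₂[-(y 1 / q.δR), y 0 - 1 + q.τR * (y 1 / q.δR)]

end BCParams

theorem halfMap_zero (τ δ : ℝ) (x : Plane) : halfMap τ δ x 0 = τ * x 0 + x 1 + 1 := by
  simp [halfMap, bcMatrix, Matrix.toLpLin_apply, dotProduct, Fin.sum_univ_two]

theorem halfMap_one (τ δ : ℝ) (x : Plane) : halfMap τ δ x 1 = -δ * x 0 := by
  simp [halfMap, bcMatrix, Matrix.toLpLin_apply, dotProduct, Fin.sum_univ_two]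

namespace BCParams

variable (q : BCParams)

/-- The two half-maps agree on the switching manifold, so `f` is given by `fR` on `x₁ ≥ 0`. -/
theorem f_of_nonneg (x : Plane) (hx : 0 ≤ x 0) : q.f x = q.fR x := by
  unfold f
  split_ifs with h
  · have h0 : x 0 = 0 := le_antisymm h hx
    ext i
    fin_cases i
    · simp [fL, fR, halfMap_zero, h0]
    · simp [fL, fR, halfMap_one, h0]
  · rfl

theorem f_fInv (hL : 0 < q.δL) (hR : 0 < q.δR) (y : Plane) : q.f (q.fInv y) = y := by
  by_cases h : 0 ≤ y 1
  · have e : q.fInv y = !₂[-(y 1 / q.δL), y 0 - 1 + q.τL * (y 1 / q.δL)] := if_pos h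
    have h1 : q.fInv y 0 ≤ 0 := by rw [e]; simpa using div_nonneg h hL.le
    rw [f, if_pos h1, e]
    ext i
    fin_cases i
    · simp [fL, halfMap_zero]
    · simp [fL, halfMap_one]; field_simp
  · have e : q.fInv y = !₂[-(y 1 / q.δR), y 0 - 1 + q.τR * (y 1 / q.δR)] := if_neg h
    have h1 : ¬ q.fInv y 0 ≤ 0 := by
      rw [e]; simpa using div_neg_of_neg_of_pos (not_le.mp h) hR
    rw [f, if_neg h1, e]
    ext i
    fin_cases i
    · simp [fR, halfMap_zero]
    · simp [fR, halfMap_one]; field_simp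

theorem fInv_f (hL : 0 < q.δL) (hR : 0 < q.δR) (x : Plane) : q.fInv (q.f x) = x := by
  by_cases h : x 0 ≤ 0
  · have e : q.f x = q.fL x := if_pos h
    have h1 : 0 ≤ q.f x 1 := by rw [e, fL, halfMap_one]; nlinarith
    rw [fInv, if_pos h1, e]
    ext i
    fin_cases i
    · simp [fL, halfMap_one]; field_simp
    · simp [fL, halfMap_zero, halfMap_one]; field_simp; ring
  · have e : q.f x = q.fR x := if_neg h
    have h1 : ¬ 0 ≤ q.f x 1 := by rw [e, fR, halfMap_one]; nlinarith
    rw [fInv, if_neg h1, e]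
    ext i
    fin_cases i
    · simp [fR, halfMap_one]; field_simp
    · simp [fR, halfMap_zero, halfMap_one]; field_simp; ring

end BCParams

/-! ### Lines in the plane -/

/-- The intersection of the line through `P` and `Q` with the line `{x | x i = 0}`
(for `P i ≠ Q i`); see `eq_meet_iff`. -/
def meet (i : Fin 2) (P Q : Plane) : Plane := AffineMap.lineMap P Q (P i / (P i - Q i))

theorem eq_meet_iff (i : Fin 2) (P Q R : Plane) (h : P i ≠ Q i) :
    R = meet i P Q ↔ R ∈ line[ℝ, P, Q] ∧ R i = 0 := by
  have h' : P i - Q i ≠ 0 := sub_ne_zero.mpr h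
  constructor
  · rintro rfl
    refine ⟨AffineMap.lineMap_mem_affineSpan_pair _ _ _, ?_⟩
    simp [meet, AffineMap.lineMap_apply]
    field_simp
    ring
  · rintro ⟨hm, h0⟩
    obtain ⟨t, rfl⟩ := mem_affineSpan_pair_iff_exists_lineMap_eq.mp hm
    have : t = P i / (P i - Q i) := by
      simp [AffineMap.lineMap_apply] at h0
      field_simp
      linarith
    rw [meet, this]

/-- `A` lies (strictly) above the non-vertical line through `P` and `Q`. -/
def LiesAbove (A P Q : Plane) : Prop := ∃ B ∈ line[ℝ, P, Q], B 0 = A 0 ∧ B 1 < A 1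

/-- `A` lies (strictly) to the right of the non-horizontal line through `P` and `Q`. -/
def LiesRightOf (A P Q : Plane) : Prop := ∃ B ∈ line[ℝ, P, Q], B 1 = A 1 ∧ B 0 < A 0

/-! ### The polygon: its defining points and the tests on them -/

/-- The point `X = (0, β)`. -/
def ptX (β : ℝ) : Plane := !₂[0, β]

namespace BCParams

variable (q : BCParams) (β : ℝ)

/-- The positive numbers of forward iterations after which `X` is in `x₁ ≤ 0`. -/
def rSet : Set ℕ := {i | 1 ≤ i ∧ (q.f^[i] (ptX β)) 0 ≤ 0}

/-- The positive numbers of backward iterations after which `X` is in `x₁ ≥ 0`. -/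
def ellSet : Set ℕ := {j | 1 ≤ j ∧ 0 ≤ (q.fInv^[j] (ptX β)) 0}

/-- The least element of `rSet` (used only if that set is nonempty). -/
def r : ℕ := sInf (q.rSet β)

/-- The least element of `ellSet` (used only if that set is nonempty). -/
def ell : ℕ := sInf (q.ellSet β)

/-- `Z = f^r(X)`. -/
def ptZ : Plane := q.f^[q.r β] (ptX β)

/-- `Y` is the intersection of the line through `Z` and `f⁻¹(Z)` with the switching
manifold `x₁ = 0`. -/
def ptY : Plane := meet 0 (q.ptZ β) (q.fInv (q.ptZ β))

/-- `V = f^{-(ℓ-1)}(X)`. Here `ℓ ≥ 1`, so the subtraction is the true one. -/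
def ptV : Plane := q.fInv^[q.ell β - 1] (ptX β)

/-- `U` is the intersection of the line through `V` and `f(V)` with the line `x₂ = 0`, which is
the image of the switching manifold. -/
def ptU : Plane := meet 1 (q.ptV β) (q.f (q.ptV β))

/-- The first test: both `r` and `ℓ` exist. -/
def C1 : Prop := (q.rSet β).Nonempty ∧ (q.ellSet β).Nonempty

/-- The second test: `Y` lies above `f⁻¹(U)` (both points are on `x₁ = 0`), `Z` lies above the line
through `f⁻¹(U)` and `V`, and `Z` lies to the right of the line through `V` and `f(V)`. -/
def C2 : Prop :=
  q.fInv (q.ptU β) 1 < q.ptY β 1 ∧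
  LiesAbove (q.ptZ β) (q.fInv (q.ptU β)) (q.ptV β) ∧
  LiesRightOf (q.ptZ β) (q.ptV β) (q.f (q.ptV β))

/-- The number of iterations of the left half-map that a point of `x₁ ≤ 0` needs to escape
from `x₁ ≤ 0`; it is `⊤` if the point never escapes. -/
def chiL (x : Plane) : ℕ∞ := sInf ((↑) '' {p : ℕ | 1 ≤ p ∧ 0 < (q.fL^[p] x) 0})

/-- The maximal power of `L` in the words `R L^p`. -/
def pMax : ℕ∞ := max (q.chiL (q.ptY β)) (q.chiL (q.ptZ β))

end BCParams

/-! ### Slope maps and the tests for the cone -/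

/-- The slope of `M (1, m)`. -/
def slopeMap (M : Matrix (Fin 2) (Fin 2) ℝ) (m : ℝ) : ℝ :=
  (M 1 0 + M 1 1 * m) / (M 0 0 + M 0 1 * m)

/-- A fixed point of the slope map (in its domain). -/
def IsSlopeFixedPt (M : Matrix (Fin 2) (Fin 2) ℝ) (m : ℝ) : Prop :=
  M 0 0 + M 0 1 * m ≠ 0 ∧ slopeMap M m = m

/-- A stable fixed point of the slope map. -/
def IsStableSlope (M : Matrix (Fin 2) (Fin 2) ℝ) (m : ℝ) : Prop :=
  IsSlopeFixedPt M m ∧ |deriv (slopeMap M) m| < 1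

/-- An unstable fixed point of the slope map. -/
def IsUnstableSlope (M : Matrix (Fin 2) (Fin 2) ℝ) (m : ℝ) : Prop :=
  IsSlopeFixedPt M m ∧ 1 < |deriv (slopeMap M) m|

/-- The quadratic `H(m) = ‖M (1, m)‖² - ‖(1, m)‖²`, expanded. -/
def quadH (M : Matrix (Fin 2) (Fin 2) ℝ) (m : ℝ) : ℝ :=
  (M 0 1 ^ 2 + M 1 1 ^ 2 - 1) * m ^ 2 + 2 * (M 0 0 * M 0 1 + M 1 0 * M 1 1) * m
    + M 0 0 ^ 2 + M 1 0 ^ 2 - 1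

theorem quadH_eq (M : Matrix (Fin 2) (Fin 2) ℝ) (m : ℝ) :
    quadH M m = ‖Matrix.toEuclideanLin M !₂[1, m]‖ ^ 2 - ‖(!₂[1, m] : Plane)‖ ^ 2 := by
  simp [quadH, EuclideanSpace.norm_sq_eq, Matrix.toLpLin_apply,
    Fin.sum_univ_two]
  ring

/-- Given the end points of the interval of slopes, the quadratic of `M` has a root `mi` at which
it is increasing and a root `md` at which it is decreasing, and (at least) two of the three
inequalities `mmax < md`, `md < mi`, `mi < mmin` hold. -/
def QuadTest (M : Matrix (Fin 2) (Fin 2) ℝ) (mmin mmax : ℝ) : Prop :=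
  ∃ mi md : ℝ, quadH M mi = 0 ∧ 0 < deriv (quadH M) mi ∧
    quadH M md = 0 ∧ deriv (quadH M) md < 0 ∧
    ((mmax < md ∧ md < mi) ∨ (mmax < md ∧ mi < mmin) ∨ (md < mi ∧ mi < mmin))

/-- The replacement of `QuadTest` when the quadratic has degree at most one: it has exactly one
root, and this root is on the correct side of the interval of slopes. -/
def LinTest (M : Matrix (Fin 2) (Fin 2) ℝ) (mmin mmax : ℝ) : Prop :=
  let k := M 0 0 * M 0 1 + M 1 0 * M 1 1
  let mroot := -(M 0 0 ^ 2 + M 1 0 ^ 2 - 1) / (2 * k)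
  (k < 0 ∧ mmax < mroot) ∨ (0 < k ∧ mroot < mmin)

namespace BCParams

variable (q : BCParams)

/-- The matrix `A_L^(j-1) A_R`, for `j ≥ 1`. -/
def wordMatrix (j : ℕ) : Matrix (Fin 2) (Fin 2) ℝ :=
  bcMatrix q.τL q.δL ^ (j - 1) * bcMatrix q.τR q.δR

/-- The third test, for words `R L^0, …, R L^p`. -/
def C3 (p : ℕ) : Prop := ∀ j ∈ Finset.Icc 1 (p + 1),
  0 < (q.wordMatrix j).det ∧ (q.wordMatrix j).det < (1 / 4) * (q.wordMatrix j).trace ^ 2 ∧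
    q.wordMatrix j 0 1 ≠ 0

/-- The stable slopes of the matrices of all the words (under `C3` each matrix has exactly one). -/
def stableSlopes (p : ℕ) : Set ℝ :=
  {m | ∃ j ∈ Finset.Icc 1 (p + 1), IsStableSlope (q.wordMatrix j) m}

/-- The least stable slope. -/
def mStabMin (p : ℕ) : ℝ := sInf (q.stableSlopes p)

/-- The greatest stable slope. -/
def mStabMax (p : ℕ) : ℝ := sSup (q.stableSlopes p)

/-- The fourth test: no unstable slope is in the interval spanned by the stable slopes. -/
def C4 (p : ℕ) : Prop := ¬ ∃ j ∈ Finset.Icc 1 (p + 1), ∃ m,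
  IsUnstableSlope (q.wordMatrix j) m ∧ q.mStabMin p ≤ m ∧ m ≤ q.mStabMax p

/-- The fifth test. -/
def C5 (p : ℕ) : Prop := ∀ j ∈ Finset.Icc 1 (p + 1),
  if q.wordMatrix j 0 1 ^ 2 + q.wordMatrix j 1 1 ^ 2 = 1 then
    LinTest (q.wordMatrix j) (q.mStabMin p) (q.mStabMax p)
  else QuadTest (q.wordMatrix j) (q.mStabMin p) (q.mStabMax p)

end BCParams

/-! ### The algorithm, in exact real arithmetic -/

/-- The variables of the while-loop: the Boolean `χ_chaos` and the current value of `β`. -/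
structure SearchState where
  chaos : Bool
  beta : ℝ

namespace BCParams

variable (q : BCParams)

/-- The guard of the while-loop. -/
def guard (βmax : ℝ) (s : SearchState) : Prop := s.chaos = false ∧ s.beta ≤ βmax

open Classical in
/-- One pass through the body of the while-loop. -/
def loopBody (βstep : ℝ) (s : SearchState) : SearchState :=
  if ¬ q.C1 s.beta then { s with beta := s.beta + βstep }
  else if ¬ q.C2 s.beta then { s with beta := s.beta + βstep }
  else { s with chaos := true }

/-- The while-loop, started in the first state, terminates in the second one. -/
inductive LoopEnds (βstep βmax : ℝ) : SearchState → SearchState → Prop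
  | exit (s : SearchState) (h : ¬ guard βmax s) : LoopEnds βstep βmax s s
  | pass (s t : SearchState) (h : guard βmax s)
      (ht : LoopEnds βstep βmax (q.loopBody βstep s) t) : LoopEnds βstep βmax s t

open Classical in
/-- The Boolean computed from the value of `p_max` after the while-loop has succeeded. -/
def coneCheck (p : ℕ) : Bool :=
  if ¬ q.C3 p then false
  else if ¬ q.C4 p then false
  else if ¬ q.C5 p then false
  else true

/-- The algorithm terminates with `χ_chaos = b`. (The evaluation of `p_max` terminates only if
`p_max` is finite.) -/
def AlgorithmOutputs (βmin βstep βmax : ℝ) (b : Bool) : Prop :=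
  ∃ s : SearchState, q.LoopEnds βstep βmax ⟨false, βmin⟩ s ∧
    ((s.chaos = true ∧ ∃ p : ℕ, q.pMax s.beta = (p : ℕ∞) ∧ q.coneCheck p = b) ∨
     (s.chaos = false ∧ b = false))

end BCParams

end

section Topological

/-! ### Trapping regions from eventually absorbed sets -/

variable {E : Type*} [TopologicalSpace E]

/-- If `f^(n+1)` maps a compact set `K` into an open set `O`, then the intermediate images of `K`
can be thickened to a compact set that is mapped into its own interior or into `O`. -/
theorem exists_compact_thickening [LocallyCompactSpace E] {f : E → E} (hf : Continuous f)
    {O : Set E} (hO : IsOpen O) (n : ℕ) : ∀ K : Set E, IsCompact K → f^[n + 1] '' K ⊆ O →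
    ∃ L : Set E, IsCompact L ∧ f '' K ⊆ interior L ∪ O ∧ f '' L ⊆ interior L ∪ O ∧
      ∀ x ∈ L, ∃ i ≤ n, f^[i] x ∈ O := by
  induction n with
  | zero =>
    intro K _ h
    exact ⟨∅, isCompact_empty, by simpa using h, by simp, by simp⟩
  | succ n ih =>
    intro K hK h
    -- K₁ is a compact neighbourhood of f(K) small enough that f^(n+1) still sends all of it into O,
    -- so the induction hypothesis applies to K₁.
    obtain ⟨K₁, hK₁, hint, hsub⟩ := exists_compact_between (hK.image hf)
      (hO.preimage (hf.iterate (n + 1))) (by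
        rintro _ ⟨x, hx, rfl⟩
        have := h ⟨x, hx, rfl⟩
        rwa [Function.iterate_succ_apply] at this)
    obtain ⟨L, hL, h1, h2, h3⟩ := ih K₁ hK₁ (by rintro _ ⟨x, hx, rfl⟩; exact hsub hx)
    have hmono : interior L ⊆ interior (K₁ ∪ L) := interior_mono Set.subset_union_right
    refine ⟨K₁ ∪ L, hK₁.union hL, ?_, ?_, ?_⟩
    · exact (hint.trans (interior_mono Set.subset_union_left)).trans Set.subset_union_left
    · rw [Set.image_union]
      exact Set.union_subset (h1.trans (Set.union_subset_union_left _ hmono))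
        (h2.trans (Set.union_subset_union_left _ hmono))
    · rintro x (hx | hx)
      · exact ⟨n + 1, le_rfl, hsub hx⟩
      · obtain ⟨i, hi, hx'⟩ := h3 x hx
        exact ⟨i, by omega, hx'⟩

/-- A forward invariant compact set that some iterate maps into its interior contains a nonempty
attracting set. -/
theorem exists_attractingSet [LocallyCompactSpace E] [T2Space E] {f : E → E} (hf : Continuous f)
    {Ω : Set E} (hΩ : IsCompact Ω) (hne : Ω.Nonempty) (hmaps : Set.MapsTo f Ω Ω) (n : ℕ)
    (hn : f^[n + 1] '' Ω ⊆ interior Ω) :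
    ∃ Λ : Set E, IsAttractingSet f Λ ∧ Λ.Nonempty ∧ Λ ⊆ f '' Ω := by
  obtain ⟨L, hL, h1, h2, h3⟩ := exists_compact_thickening hf isOpen_interior n Ω hΩ hn
  have hc : IsCompact (Ω ∪ L) := hΩ.union hL
  have hsub : interior L ∪ interior Ω ⊆ interior (Ω ∪ L) :=
    Set.union_subset (interior_mono Set.subset_union_right)
      (interior_mono Set.subset_union_left)
  have htrap : f '' (Ω ∪ L) ⊆ interior (Ω ∪ L) := by
    rw [Set.image_union]
    exact Set.union_subset (h1.trans hsub) (h2.trans hsub)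
  have hmaps' : Set.MapsTo f (Ω ∪ L) (Ω ∪ L) := fun x hx =>
    interior_subset (htrap ⟨x, hx, rfl⟩)
  refine ⟨_, ⟨Ω ∪ L, ⟨hc, htrap⟩, rfl⟩, ?_, ?_⟩
  · refine IsCompact.nonempty_iInter_of_sequence_nonempty_isCompact_isClosed _ ?_ ?_ ?_ ?_
    · rintro i _ ⟨x, hx, rfl⟩
      exact ⟨f x, hmaps' hx, (Function.iterate_succ_apply f i x).symm⟩
    · exact fun i => (hne.mono Set.subset_union_left).image _
    · simpa using hc
    · exact fun i => (hc.image (hf.iterate i)).isClosed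
  · intro x hx
    -- Points of the thickening reach Ω within n steps and stay there, so the (n+1)-st image already
    -- lies in f(Ω).
    obtain ⟨z, hz, rfl⟩ := Set.mem_iInter.mp hx (n + 1)
    have key : f^[n] z ∈ Ω := by
      rcases hz with hz | hz
      · exact hmaps.iterate n hz
      · obtain ⟨i, hi, hzi⟩ := h3 z hz
        have := hmaps.iterate (n - i) (interior_subset hzi)
        rwa [← Function.iterate_add_apply, Nat.sub_add_cancel hi] at this
    exact ⟨_, key, (Function.iterate_succ_apply' f n z).symm⟩

end Topological

/-! ### Exponential growth rates -/

section Lyapunov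

variable {E : Type*} [NormedAddCommGroup E]

theorem log_enorm_div_le {d : E} {n : ℕ} {C : ℝ} (hn : 1 ≤ n) (h : ‖d‖ ≤ Real.exp (C * n)) :
    ENNReal.log ‖d‖ₑ / ((n : ℝ) : EReal) ≤ (C : EReal) := by
  have hn' : (0 : EReal) < ((n : ℝ) : EReal) := by exact_mod_cast hn
  rw [EReal.div_le_iff_le_mul hn' (EReal.coe_ne_top _)]
  have : ‖d‖ₑ ≤ ENNReal.ofReal (Real.exp (C * n)) := by
    rw [← ofReal_norm]; exact ENNReal.ofReal_le_ofReal h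
  refine (ENNReal.log_le_log_iff.mpr this).trans ?_
  rw [ENNReal.log_ofReal_of_pos (Real.exp_pos _), Real.log_exp, mul_comm C]
  push_cast
  exact le_rfl

theorem le_log_enorm_div {d : E} {n : ℕ} {C : ℝ} (hn : 1 ≤ n) (h : Real.exp (C * n) ≤ ‖d‖) :
    (C : EReal) ≤ ENNReal.log ‖d‖ₑ / ((n : ℝ) : EReal) := by
  have hn' : (0 : EReal) < ((n : ℝ) : EReal) := by exact_mod_cast hn
  rw [EReal.le_div_iff_mul_le hn' (EReal.coe_ne_top _)]
  have : ENNReal.ofReal (Real.exp (C * n)) ≤ ‖d‖ₑ := by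
    rw [← ofReal_norm]; exact ENNReal.ofReal_le_ofReal h
  refine le_trans ?_ (ENNReal.log_le_log_iff.mpr this)
  rw [ENNReal.log_ofReal_of_pos (Real.exp_pos _), Real.log_exp]
  push_cast
  exact le_rfl

/-- A sequence that grows at most exponentially and, along a subsequence, at least exponentially
has a positive real upper exponential growth rate. -/
theorem exists_pos_limsup_log {D : ℕ → E} {c C : ℝ} (hc : 0 < c)
    (hlow : ∃ᶠ n : ℕ in atTop, Real.exp (c * n) ≤ ‖D n‖)
    (hup : ∀ᶠ n : ℕ in atTop, ‖D n‖ ≤ Real.exp (C * n)) :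
    ∃ lam : ℝ, 0 < lam ∧
      limsup (fun n : ℕ => ENNReal.log ‖D n‖ₑ / ((n : ℝ) : EReal)) atTop = (lam : EReal) := by
  set L := limsup (fun n : ℕ => ENNReal.log ‖D n‖ₑ / ((n : ℝ) : EReal)) atTop with hL
  have h1 : L ≤ (C : EReal) := by
    refine limsup_le_of_le ?_ ?_
    · isBoundedDefault
    · filter_upwards [hup, eventually_ge_atTop 1] with n hn hn1
      exact log_enorm_div_le hn1 hn
  have h2 : (c : EReal) ≤ L := by
    refine le_limsup_of_frequently_le ?_ ?_
    · exact (hlow.and_eventually (eventually_ge_atTop 1)).mono fun n hn =>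
        le_log_enorm_div hn.2 hn.1
    · isBoundedDefault
  have hT : L ≠ ⊤ := fun h => by rw [h] at h1; simp at h1
  have hB : L ≠ ⊥ := fun h => by rw [h] at h2; simp at h2
  refine ⟨L.toReal, ?_, (EReal.coe_toReal hT hB).symm⟩
  rw [← EReal.coe_toReal hT hB] at h2
  exact hc.trans_le (EReal.coe_le_coe_iff.mp h2)

/-- Expansion by a factor `c > 1` at least once in every `q` steps implies a positive real upper
exponential growth rate. -/
theorem exists_pos_limsup_log_of_blocks {D : ℕ → E} {c a C B : ℝ} {k q : ℕ} (hc : 1 < c)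
    (ha : 0 < a) (hC : 1 ≤ C) (hB : 1 ≤ B)
    (hlow : ∀ i : ℕ, ∃ n, i ≤ n ∧ n ≤ k + i * q ∧ a * c ^ i ≤ ‖D n‖)
    (hup : ∀ n, ‖D n‖ ≤ C ^ n * B) :
    ∃ lam : ℝ, 0 < lam ∧
      limsup (fun n : ℕ => ENNReal.log ‖D n‖ₑ / ((n : ℝ) : EReal)) atTop = (lam : EReal) := by
  have hlc : 0 < Real.log c := Real.log_pos hc
  have hq : (0 : ℝ) < q + 1 := by positivity
  -- Half of a guaranteed rate per step: the other half absorbs the delay k and the constant a once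
  -- i is large. Using q + 1 avoids division by zero.
  set e := Real.log c / (2 * (q + 1)) with he
  have he0 : 0 < e := by positivity
  refine exists_pos_limsup_log (c := e) (C := Real.log C + Real.log B) he0 ?_ ?_
  · rw [frequently_atTop]
    intro N
    obtain ⟨I, hI⟩ := exists_nat_ge ((e * k - Real.log a) / (Real.log c / 2))
    obtain ⟨n, hn1, hn2, hn3⟩ := hlow (max N I)
    refine ⟨n, (le_max_left _ _).trans hn1, le_trans ?_ hn3⟩
    set i := max N I with hi
    have hIi : (I : ℝ) ≤ i := by exact_mod_cast le_max_right N I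
    have h1 : (e * k - Real.log a) ≤ i * (Real.log c / 2) := by
      rw [div_le_iff₀ (by positivity)] at hI
      exact hI.trans (by gcongr)
    have hn2' : (n : ℝ) ≤ k + i * (q + 1) := by
      have : (n : ℝ) ≤ k + i * q := by exact_mod_cast hn2
      nlinarith [(Nat.cast_nonneg i : (0 : ℝ) ≤ i)]
    have h2 : e * (i * (q + 1)) = i * (Real.log c / 2) := by
      rw [he]; field_simp
    have h3 : e * n ≤ Real.log a + i * Real.log c := by
      have := mul_le_mul_of_nonneg_left hn2' he0.le
      nlinarith
    calc Real.exp (e * n) ≤ Real.exp (Real.log a + i * Real.log c) := Real.exp_le_exp.mpr h3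
      _ = a * c ^ i := by
        rw [Real.exp_add, Real.exp_log ha, ← Real.log_pow, Real.exp_log (by positivity)]
  · filter_upwards [eventually_ge_atTop 1] with n hn
    refine (hup n).trans ?_
    have hn' : (1 : ℝ) ≤ n := by exact_mod_cast hn
    have hlB : 0 ≤ Real.log B := Real.log_nonneg hB
    calc C ^ n * B = Real.exp (n * Real.log C + Real.log B) := by
          rw [Real.exp_add, Real.exp_log (by positivity), ← Real.log_pow,
            Real.exp_log (by positivity)]
      _ ≤ _ := Real.exp_le_exp.mpr (by nlinarith)

end Lyapunov

/-! ### Slope maps and the expansion quadratic of a single matrix -/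

section SlopeMaps

variable {M : Matrix (Fin 2) (Fin 2) ℝ}

theorem deriv_slopeMap {m : ℝ} (h : M 0 0 + M 0 1 * m ≠ 0) :
    deriv (slopeMap M) m = M.det / (M 0 0 + M 0 1 * m) ^ 2 := by
  have h1 : HasDerivAt (fun m : ℝ => M 1 0 + M 1 1 * m) (M 1 1) m := by
    simpa using ((hasDerivAt_id m).const_mul (M 1 1)).const_add (M 1 0)
  have h2 : HasDerivAt (fun m : ℝ => M 0 0 + M 0 1 * m) (M 0 1) m := by
    simpa using ((hasDerivAt_id m).const_mul (M 0 1)).const_add (M 0 0)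
  have h3 : HasDerivAt (slopeMap M)
      ((M 1 1 * (M 0 0 + M 0 1 * m) - (M 1 0 + M 1 1 * m) * M 0 1) /
        (M 0 0 + M 0 1 * m) ^ 2) m := h1.div h2 h
  rw [h3.deriv, Matrix.det_fin_two]
  congr 1
  ring

theorem isSlopeFixedPt_iff {m : ℝ} : IsSlopeFixedPt M m ↔
    M 0 0 + M 0 1 * m ≠ 0 ∧ M 1 0 + M 1 1 * m = m * (M 0 0 + M 0 1 * m) := by
  unfold IsSlopeFixedPt slopeMap
  refine and_congr_right fun h => ?_
  rw [div_eq_iff h]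

/-- Under the third test, a slope map has a stable and an unstable fixed point; they are the slopes
of eigenvectors whose eigenvalues have the same sign. -/
theorem exists_slopes (h0 : 0 < M.det) (h1 : M.det < (1 / 4) * M.trace ^ 2) (hb : M 0 1 ≠ 0) :
    ∃ ms mu ls lu : ℝ, IsStableSlope M ms ∧ IsUnstableSlope M mu ∧ ms ≠ mu ∧
      M 0 0 + M 0 1 * ms = ls ∧ M 1 0 + M 1 1 * ms = ls * ms ∧
      M 0 0 + M 0 1 * mu = lu ∧ M 1 0 + M 1 1 * mu = lu * mu ∧ 0 < lu / ls ∧ lu / ls < 1 ∧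
      ls + lu = M.trace ∧ ls * lu = M.det ∧ ∀ m, IsStableSlope M m → m = ms := by
  set T := M.trace with hT
  set d := M.det with hd
  have hdisc : 0 < T ^ 2 - 4 * d := by linarith
  set S := √(T ^ 2 - 4 * d) with hS
  have hSpos : 0 < S := Real.sqrt_pos.mpr hdisc
  have hSsq : S ^ 2 = T ^ 2 - 4 * d := Real.sq_sqrt hdisc.le
  have hT0 : T ≠ 0 := by rintro h; rw [h] at h1; nlinarith
  have htr : T = M 0 0 + M 1 1 := Matrix.trace_fin_two M
  have hdet : d = M 0 0 * M 1 1 - M 0 1 * M 1 0 := Matrix.det_fin_two M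
  -- The slope m of an eigenvector (1, m) with eigenvalue l has derivative det / l², so the stable
  -- slope belongs to the eigenvalue of larger modulus; the sign of the trace decides which root
  -- that is.
  obtain ⟨ls, lu, hsum, hprod, hlt⟩ : ∃ ls lu : ℝ, ls + lu = T ∧ ls * lu = d ∧
      lu ^ 2 < ls ^ 2 := by
    rcases lt_or_gt_of_ne hT0 with h | h
    · exact ⟨(T - S) / 2, (T + S) / 2, by ring, by nlinarith, by nlinarith⟩
    · exact ⟨(T + S) / 2, (T - S) / 2, by ring, by nlinarith, by nlinarith⟩
  have hls : ls ≠ 0 := by rintro rfl; nlinarith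
  have hlu : lu ≠ 0 := by rintro rfl; nlinarith
  have key : ∀ l : ℝ, l ^ 2 - T * l + d = 0 →
      M 0 0 + M 0 1 * ((l - M 0 0) / M 0 1) = l ∧
      M 1 0 + M 1 1 * ((l - M 0 0) / M 0 1) = l * ((l - M 0 0) / M 0 1) := by
    intro l hl
    constructor
    · field_simp; ring
    · field_simp
      rw [htr, hdet] at hl
      linarith
  obtain ⟨ks1, ks2⟩ := key ls (by rw [← hsum, ← hprod]; ring)
  obtain ⟨ku1, ku2⟩ := key lu (by rw [← hsum, ← hprod]; ring)
  have hder : ∀ m l : ℝ, l ≠ 0 → M 0 0 + M 0 1 * m = l →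
      deriv (slopeMap M) m = ls * lu / l ^ 2 := by
    intro m l hl hm
    rw [deriv_slopeMap (by rw [hm]; exact hl), hm, hprod]
  have hprodpos : 0 < ls * lu := by rw [hprod]; exact h0
  have hstab : ∀ m, IsSlopeFixedPt M m → M 0 0 + M 0 1 * m = ls ∨ M 0 0 + M 0 1 * m = lu := by
    intro m hm
    rw [isSlopeFixedPt_iff] at hm
    have : (M 0 0 + M 0 1 * m - ls) * (M 0 0 + M 0 1 * m - lu) = 0 := by
      have e1 : (M 0 0 + M 0 1 * m - ls) * (M 0 0 + M 0 1 * m - lu)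
        = (M 0 0 + M 0 1 * m) ^ 2 - T * (M 0 0 + M 0 1 * m) + d := by
          rw [← hsum, ← hprod]; ring
      rw [e1, htr, hdet]
      linear_combination -(M 0 1) * hm.2
    rcases mul_eq_zero.mp this with h | h
    · exact Or.inl (by linarith)
    · exact Or.inr (by linarith)
  refine ⟨(ls - M 0 0) / M 0 1, (lu - M 0 0) / M 0 1, ls, lu, ⟨?_, ?_⟩, ⟨?_, ?_⟩, ?_, ks1, ks2,
    ku1, ku2, ?_, ?_, hsum, hprod, ?_⟩
  · rw [isSlopeFixedPt_iff, ks1, ks2]; exact ⟨hls, by ring⟩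
  · rw [hder _ ls hls ks1, abs_of_pos (by positivity), div_lt_one (by positivity)]
    nlinarith
  · rw [isSlopeFixedPt_iff, ku1, ku2]; exact ⟨hlu, by ring⟩
  · rw [hder _ lu hlu ku1, abs_of_pos (by positivity), one_lt_div (by positivity)]
    nlinarith
  · intro h
    rw [div_left_inj' hb] at h
    have : ls = lu := by linarith
    rw [this] at hlt
    exact lt_irrefl _ hlt
  · have : lu / ls = ls * lu / ls ^ 2 := by field_simp
    rw [this]; positivity
  · have : lu / ls = ls * lu / ls ^ 2 := by field_simp
    rw [this, div_lt_one (by positivity)]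
    nlinarith
  · intro m hm
    rcases hstab m hm.1 with h | h
    · rw [eq_div_iff hb]; linarith
    · exfalso
      have h2 := hm.2
      rw [hder _ lu hlu h, abs_of_pos (by positivity), div_lt_one (by positivity)] at h2
      nlinarith

/-- A slope map contracts towards its stable fixed point on any interval that does not contain the
unstable one. -/
theorem slopeMap_mem_Icc {ms mu ls lu x y : ℝ} (hne : ms ≠ mu)
    (hs1 : M 0 0 + M 0 1 * ms = ls) (hs2 : M 1 0 + M 1 1 * ms = ls * ms)
    (hu1 : M 0 0 + M 0 1 * mu = lu) (hu2 : M 1 0 + M 1 1 * mu = lu * mu)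
    (h0 : 0 < lu / ls) (h1 : lu / ls < 1) (hms : ms ∈ Set.Icc x y) (hmu : mu ∉ Set.Icc x y)
    {m : ℝ} (hm : m ∈ Set.Icc x y) :
    M 0 0 + M 0 1 * m ≠ 0 ∧ slopeMap M m ∈ Set.Icc x y := by
  have hls : ls ≠ 0 := by rintro rfl; simp at h0
  set ρ := lu / ls with hρ
  have hlu : lu = ρ * ls := by rw [hρ]; field_simp
  have hd : ms - mu ≠ 0 := sub_ne_zero.mpr hne
  -- In the eigenbasis (1, ms), (1, mu), the vector (1, m) has coordinates α and 1 - α. Here α > 0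
  -- because m and ms lie on the same side of mu; the slope map then multiplies m - ms by ρ / w,
  -- which lies in [0, 1].
  set α := (m - mu) / (ms - mu) with hα
  have hαpos : 0 < α := by
    rw [hα]
    rcases lt_or_ge mu x with h | h
    · exact div_pos (by linarith [hm.1]) (by linarith [hms.1])
    · have h' : y < mu := not_le.mp fun h' => hmu ⟨h, h'⟩
      exact div_pos_of_neg_of_neg (by linarith [hm.2]) (by linarith [hms.2])
  have hmα : m = α * ms + (1 - α) * mu := by rw [hα]; field_simp; ring
  set w := α + ρ * (1 - α) with hw
  have hwρ : ρ < w := by rw [hw]; nlinarith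
  have hwpos : 0 < w := h0.trans hwρ
  have e1 : M 0 0 + M 0 1 * m = ls * w := by
    rw [hmα, hw]
    linear_combination α * hs1 + (1 - α) * hu1 + (1 - α) * hlu
  have e2 : M 1 0 + M 1 1 * m = ls * (α * ms + ρ * (1 - α) * mu) := by
    rw [hmα]
    linear_combination α * hs2 + (1 - α) * hu2 + (1 - α) * mu * hlu
  have e3 : slopeMap M m = ms + ρ / w * (m - ms) := by
    rw [slopeMap, e1, e2, mul_div_mul_left _ _ hls]
    field_simp
    rw [hw, hmα]; ring
  have hθ0 : 0 ≤ ρ / w := by positivity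
  have hθ1 : ρ / w ≤ 1 := by rw [div_le_one hwpos]; exact hwρ.le
  refine ⟨by rw [e1]; exact mul_ne_zero hls hwpos.ne', ?_⟩
  rw [e3]
  constructor
  · nlinarith [hms.1, hm.1]
  · nlinarith [hms.2, hm.2]

theorem deriv_quadH (m : ℝ) : deriv (quadH M) m =
    2 * (M 0 1 ^ 2 + M 1 1 ^ 2 - 1) * m + 2 * (M 0 0 * M 0 1 + M 1 0 * M 1 1) := by
  have h : HasDerivAt (quadH M) ((M 0 1 ^ 2 + M 1 1 ^ 2 - 1) * (2 * m) +
      2 * (M 0 0 * M 0 1 + M 1 0 * M 1 1)) m := by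
    have h1 := ((hasDerivAt_pow 2 m).const_mul (M 0 1 ^ 2 + M 1 1 ^ 2 - 1)).add
      ((hasDerivAt_id m).const_mul (2 * (M 0 0 * M 0 1 + M 1 0 * M 1 1)))
    have h2 := (h1.add_const (M 0 0 ^ 2)).add_const (M 1 0 ^ 2) |>.sub_const 1
    refine h2.congr_deriv ?_
    norm_num
  rw [h.deriv]; ring

/-- With leading coefficient A, half the difference of the derivatives at the two roots is A (mi -
md), which is positive. So the sign of A is the order of the roots, and any two of the three
inequalities place the interval where the quadratic is positive. -/
theorem quadH_pos_of_quadTest {x y m : ℝ} (h : QuadTest M x y) (hm : m ∈ Set.Icc x y) :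
    0 < quadH M m := by
  obtain ⟨mi, md, hi, hi', hd, hd', h⟩ := h
  rw [deriv_quadH] at hi' hd'
  set A := M 0 1 ^ 2 + M 1 1 ^ 2 - 1 with hA
  set k := M 0 0 * M 0 1 + M 1 0 * M 1 1
  have hne : mi ≠ md := by rintro rfl; linarith
  have hfac : ∀ m, quadH M m = A * (m - mi) * (m - md) := by
    have hq : ∀ m, quadH M m = A * m ^ 2 + 2 * k * m + (M 0 0 ^ 2 + M 1 0 ^ 2 - 1) := by
      intro m; simp only [quadH, hA]; ring
    have e1 : 2 * k = -A * (mi + md) := by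
      apply mul_left_cancel₀ (sub_ne_zero.mpr hne)
      linear_combination hi - hd - hq mi + hq md
    intro m
    rw [hq, e1]
    linear_combination hi - hq mi - mi * e1
  have hpos : 0 < A * (mi - md) := by linarith
  have hcase : (m < md ∧ md < mi) ∨ (m < md ∧ mi < m) ∨ (md < mi ∧ mi < m) := by
    rcases h with h | h | h
    · exact Or.inl ⟨hm.2.trans_lt h.1, h.2⟩
    · exact Or.inr (Or.inl ⟨hm.2.trans_lt h.1, h.2.trans_le hm.1⟩)
    · exact Or.inr (Or.inr ⟨h.1, h.2.trans_le hm.1⟩)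
  rw [hfac]
  rcases hcase with ⟨h1, h2⟩ | ⟨h1, h2⟩ | ⟨h1, h2⟩
  · have hA' : 0 < A := pos_of_mul_pos_left hpos (by linarith)
    have := mul_pos (sub_pos.mpr h1) (sub_pos.mpr (h1.trans h2))
    nlinarith
  · have hA' : A < 0 := by
      by_contra hcon
      have := mul_nonpos_of_nonneg_of_nonpos (not_lt.mp hcon) (by linarith : mi - md ≤ 0)
      linarith
    have := mul_pos (sub_pos.mpr h1) (sub_pos.mpr h2)
    nlinarith
  · have hA' : 0 < A := pos_of_mul_pos_left hpos (by linarith)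
    have := mul_pos (sub_pos.mpr h2) (sub_pos.mpr (h1.trans h2))
    nlinarith

theorem quadH_pos_of_linTest {x y m : ℝ} (hA : M 0 1 ^ 2 + M 1 1 ^ 2 = 1) (h : LinTest M x y)
    (hm : m ∈ Set.Icc x y) : 0 < quadH M m := by
  unfold LinTest at h
  set k := M 0 0 * M 0 1 + M 1 0 * M 1 1 with hk
  have hq : quadH M m = 2 * k * m + (M 0 0 ^ 2 + M 1 0 ^ 2 - 1) := by
    simp only [quadH, hA]; ring
  rw [hq]
  rcases h with ⟨h1, h2⟩ | ⟨h1, h2⟩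
  · have := hm.2.trans_lt h2
    rw [lt_div_iff_of_neg (by linarith)] at this
    linarith
  · have := h2.trans_le hm.1
    rw [div_lt_iff₀ (by linarith)] at this
    linarith

/-- Turns positivity of the quadratic at a stable slope into an eigenvalue of modulus above 1. -/
theorem quadH_eq_of_eigen {m l : ℝ} (h1 : M 0 0 + M 0 1 * m = l)
    (h2 : M 1 0 + M 1 1 * m = l * m) : quadH M m = (l ^ 2 - 1) * (1 + m ^ 2) := by
  have : quadH M m = (M 0 0 + M 0 1 * m) ^ 2 + (M 1 0 + M 1 1 * m) ^ 2 - 1 - m ^ 2 := by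
    simp only [quadH]; ring
  rw [this, h1, h2]; ring

end SlopeMaps

/-! ### The invariant expanding cone -/

namespace BCParams

variable (q : BCParams)

theorem stableSlopes_finite {p : ℕ} (h3 : q.C3 p) : (q.stableSlopes p).Finite := by
  have : q.stableSlopes p = ⋃ j ∈ Finset.Icc 1 (p + 1), {m | IsStableSlope (q.wordMatrix j) m} := by
    ext m; simp [stableSlopes]
  rw [this]
  refine Set.Finite.biUnion (Finset.finite_toSet _) fun j hj => ?_
  obtain ⟨a, b, c⟩ := h3 j hj
  obtain ⟨ms, -, -, -, -, -, -, -, -, -, -, -, -, -, -, h⟩ := exists_slopes a b c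
  exact (Set.finite_singleton ms).subset fun m hm => h m hm

theorem mem_Icc_of_mem_stableSlopes {p : ℕ} (h3 : q.C3 p) {m : ℝ} (hm : m ∈ q.stableSlopes p) :
    m ∈ Set.Icc (q.mStabMin p) (q.mStabMax p) :=
  ⟨csInf_le (q.stableSlopes_finite h3).bddBelow hm, le_csSup (q.stableSlopes_finite h3).bddAbove hm⟩

theorem quadH_pos {p : ℕ} (h5 : q.C5 p) {j : ℕ} (hj : j ∈ Finset.Icc 1 (p + 1)) {m : ℝ}
    (hm : m ∈ Set.Icc (q.mStabMin p) (q.mStabMax p)) : 0 < quadH (q.wordMatrix j) m := by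
  have := h5 j hj
  split_ifs at this with h
  · exact quadH_pos_of_linTest h this hm
  · exact quadH_pos_of_quadTest this hm

/-- The interval contains every stable slope by construction and no unstable one by (C4), so each
slope map moves its points towards its own stable slope. -/
theorem slopeMap_mapsTo {p : ℕ} (h3 : q.C3 p) (h4 : q.C4 p) {j : ℕ}
    (hj : j ∈ Finset.Icc 1 (p + 1)) {m : ℝ}
    (hm : m ∈ Set.Icc (q.mStabMin p) (q.mStabMax p)) :
    q.wordMatrix j 0 0 + q.wordMatrix j 0 1 * m ≠ 0 ∧
      slopeMap (q.wordMatrix j) m ∈ Set.Icc (q.mStabMin p) (q.mStabMax p) := by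
  obtain ⟨a, b, c⟩ := h3 j hj
  obtain ⟨ms, mu, ls, lu, hs, hu, hne, h1, h2, h1', h2', h0, h01, -⟩ := exists_slopes a b c
  exact slopeMap_mem_Icc hne h1 h2 h1' h2' h0 h01
    (q.mem_Icc_of_mem_stableSlopes h3 ⟨j, hj, hs⟩) (fun h => h4 ⟨j, hj, mu, hu, h.1, h.2⟩) hm

/-- The vectors whose slope lies between the extreme stable slopes. -/
def cone (p : ℕ) : Set Plane :=
  {v | v 0 ≠ 0 ∧ v 1 / v 0 ∈ Set.Icc (q.mStabMin p) (q.mStabMax p)}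

theorem toEuclideanLin_zero (M : Matrix (Fin 2) (Fin 2) ℝ) (v : Plane) :
    Matrix.toEuclideanLin M v 0 = M 0 0 * v 0 + M 0 1 * v 1 := by
  simp [Matrix.toLpLin_apply]

theorem toEuclideanLin_one (M : Matrix (Fin 2) (Fin 2) ℝ) (v : Plane) :
    Matrix.toEuclideanLin M v 1 = M 1 0 * v 0 + M 1 1 * v 1 := by
  simp [Matrix.toLpLin_apply]

theorem wordMatrix_mem_cone {p : ℕ} (h3 : q.C3 p) (h4 : q.C4 p) {j : ℕ}
    (hj : j ∈ Finset.Icc 1 (p + 1)) {v : Plane} (hv : v ∈ q.cone p) :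
    Matrix.toEuclideanLin (q.wordMatrix j) v ∈ q.cone p := by
  obtain ⟨hv0, hm⟩ := hv
  obtain ⟨h1, h2⟩ := q.slopeMap_mapsTo h3 h4 hj hm
  set m := v 1 / v 0 with hmdef
  have e : v 1 = m * v 0 := by rw [hmdef]; field_simp
  have e0 : Matrix.toEuclideanLin (q.wordMatrix j) v 0 =
      (q.wordMatrix j 0 0 + q.wordMatrix j 0 1 * m) * v 0 := by
    rw [toEuclideanLin_zero, e]; ring
  have e1 : Matrix.toEuclideanLin (q.wordMatrix j) v 1 =
      (q.wordMatrix j 1 0 + q.wordMatrix j 1 1 * m) * v 0 := by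
    rw [toEuclideanLin_one, e]; ring
  refine ⟨by rw [e0]; exact mul_ne_zero h1 hv0, ?_⟩
  rw [e0, e1, mul_div_mul_right _ _ hv0]
  exact h2

/-- The matrices of all words expand the vectors of the cone by a uniform factor. -/
theorem exists_expansion {p : ℕ} (h5 : q.C5 p) : ∃ c : ℝ, 1 < c ∧
    ∀ j ∈ Finset.Icc 1 (p + 1), ∀ v ∈ q.cone p,
      c * ‖v‖ ≤ ‖Matrix.toEuclideanLin (q.wordMatrix j) v‖ := by
  have hsq : ∀ v : Plane, ‖v‖ ^ 2 = v 0 ^ 2 + v 1 ^ 2 := fun v => by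
    simp [EuclideanSpace.norm_sq_eq, Fin.sum_univ_two]
  have step : ∀ j ∈ Finset.Icc 1 (p + 1), ∃ c : ℝ, 1 < c ∧ ∀ v ∈ q.cone p,
      c * ‖v‖ ≤ ‖Matrix.toEuclideanLin (q.wordMatrix j) v‖ := by
    intro j hj
    by_cases hne : (Set.Icc (q.mStabMin p) (q.mStabMax p)).Nonempty
    swap
    · refine ⟨2, by norm_num, fun v hv => absurd ⟨_, hv.2⟩ hne⟩
    have hcont : ContinuousOn (fun m => quadH (q.wordMatrix j) m / (1 + m ^ 2))
        (Set.Icc (q.mStabMin p) (q.mStabMax p)) := by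
      refine Continuous.continuousOn (Continuous.div ?_ (by fun_prop) fun m => by positivity)
      unfold quadH; fun_prop
    obtain ⟨m₀, hm₀, hmin⟩ := isCompact_Icc.exists_isMinOn hne hcont
    set h₀ := quadH (q.wordMatrix j) m₀ / (1 + m₀ ^ 2) with hh₀
    have hpos : 0 < h₀ := div_pos (q.quadH_pos h5 hj hm₀) (by positivity)
    -- For v of slope m, ‖M v‖² / ‖v‖² = 1 + H(m) / (1 + m²), and h₀ is the positive minimum of the
    -- last term on the compact interval of slopes.
    refine ⟨√(1 + h₀), by rw [Real.lt_sqrt] <;> linarith, fun v hv => ?_⟩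
    refine le_of_sq_le_sq ?_ (norm_nonneg _)
    rw [mul_pow, Real.sq_sqrt (by linarith), hsq, hsq, toEuclideanLin_zero, toEuclideanLin_one]
    obtain ⟨hv0, hm⟩ := hv
    have hle : h₀ ≤ quadH (q.wordMatrix j) (v 1 / v 0) / (1 + (v 1 / v 0) ^ 2) := hmin hm
    set m := v 1 / v 0 with hmdef
    have e : v 1 = m * v 0 := by rw [hmdef]; field_simp
    rw [le_div_iff₀ (by positivity), quadH] at hle
    rw [e]
    clear_value h₀
    have := mul_le_mul_of_nonneg_right hle (sq_nonneg (v 0))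
    linarith
  choose! c hc using step
  obtain ⟨j₀, hj₀, hmin⟩ := (Finset.Icc 1 (p + 1)).exists_min_image c ⟨1, by simp⟩
  exact ⟨c j₀, (hc j₀ hj₀).1, fun j hj v hv =>
    (mul_le_mul_of_nonneg_right (hmin j hj) (norm_nonneg _)).trans ((hc j hj).2 v hv)⟩

end BCParams

/-! ### Geometry of the polygon -/

noncomputable section

/-- The data that determine the polygon: the first coordinates `u` of an orbit of the left half-map
that passes through `V` (index `2`) and reaches `X = (0, β)` at index `n + 3`. -/
structure PolygonData where
  (τ δ τR δR β : ℝ)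
  (n : ℕ)
  (u : ℕ → ℝ)
  δ_pos : 0 < δ
  δR_pos : 0 < δR
  β_pos : 0 < β
  τR_lt : τR < -1
  u_rec : ∀ k, u (k + 2) = τ * u (k + 1) - δ * u k + 1
  u_one : 0 ≤ u 1
  u_neg : ∀ k, k ≤ n → u (k + 2) < 0
  u_end : u (n + 3) = 0
  β_eq : β = -δ * u (n + 2)
  n_eq : τ ≤ 0 → n = 0

namespace PolygonData

variable (P : PolygonData)

/-- The increments of the first coordinates. -/
def s (k : ℕ) : ℝ := P.u (k + 1) - P.u k

/-- The convexity defect of consecutive increments. -/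
def kap (k : ℕ) : ℝ := P.s (k + 1) ^ 2 - P.s k * P.s (k + 2)

/-- The affine function that vanishes on the `k`-th edge line of the left chain and is positive
inside the polygon. -/
def g (k : ℕ) (a b : ℝ) : ℝ :=
  -P.δ * P.s k * (a - P.u (k + 1)) - P.s (k + 1) * (b + P.δ * P.u k)

/-- The affine function that vanishes on the line through `f X` and `Z`. -/
def K (a b : ℝ) : ℝ :=
  -P.δR * (P.β + 1) * (a - P.β - 1) - (P.τR * (P.β + 1) - P.β) * b

/-- The second coordinate of `Y`. -/
def Y2 : ℝ := -P.δR * (P.β + 1) ^ 2 / (P.β - P.τR * (P.β + 1))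

theorem s_rec (k : ℕ) : P.s (k + 2) = P.τ * P.s (k + 1) - P.δ * P.s k := by
  simp only [s]
  rw [P.u_rec (k + 1), P.u_rec k]
  ring

/-- The edge vectors (s (k+1), -δ s k) are successive images under A_L. The determinant of two
consecutive ones is -δ `kap k`, and A_L has determinant δ. -/
theorem kap_succ (k : ℕ) : P.kap (k + 1) = P.δ * P.kap k := by
  simp only [kap]
  rw [P.s_rec (k + 1), P.s_rec k]
  ring

theorem kap_eq (k : ℕ) : P.kap k = P.δ ^ k * P.kap 0 := by
  induction k with
  | zero => simp
  | succ k ih => rw [kap_succ, ih]; ring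

theorem s_one_neg : P.s 1 < 0 := by
  have := P.u_neg 0 (Nat.zero_le _)
  have := P.u_one
  simp only [s]
  norm_num at *
  linarith

theorem δ_mul_s : P.δ * P.s (P.n + 2) = P.β := by
  simp only [s, P.u_end, P.β_eq]; ring

theorem s_end_pos : 0 < P.s (P.n + 2) :=
  pos_of_mul_pos_right (by rw [δ_mul_s]; exact P.β_pos) P.δ_pos.le

theorem s_last : P.s (P.n + 3) = P.β + 1 := by
  simp only [s, P.u_end, P.u_rec (P.n + 2), P.β_eq]; ring

/-- The chain turns in the same sense at every vertex. By `kap_eq` one index suffices: for τ > 0, a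
place where the increments change sign; for τ ≤ 0, the end of the chain. -/
theorem kap_pos (k : ℕ) : 0 < P.kap k := by
  suffices h : ∃ j, 0 < P.kap j by
    obtain ⟨j, hj⟩ := h
    rw [kap_eq] at hj ⊢
    have := pos_of_mul_pos_right hj (pow_pos P.δ_pos j).le
    exact mul_pos (pow_pos P.δ_pos k) this
  rcases le_or_gt P.τ 0 with hτ | hτ
  · refine ⟨P.n + 2, ?_⟩
    have h1 := P.s_end_pos
    have h2 : 0 < P.s (P.n + 3) := by rw [s_last]; linarith [P.β_pos]
    simp only [kap, P.s_rec (P.n + 2)]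
    have := mul_pos h1 h2
    have := mul_pos P.δ_pos (mul_pos h1 h1)
    nlinarith
  · obtain ⟨k, hk1, hk2⟩ : ∃ k, P.s k < 0 ∧ 0 ≤ P.s (k + 1) := by
      by_contra! hcon
      have : ∀ k, P.s (k + 1) < 0 := by
        intro k
        induction k with
        | zero => exact P.s_one_neg
        | succ k ih => exact hcon _ ih
      exact absurd P.s_end_pos (not_lt.mpr (this (P.n + 1)).le)
    refine ⟨k, ?_⟩
    simp only [kap, P.s_rec k]
    have h1 : 0 ≤ -P.s k * P.s (k + 1) * P.τ := by
      have : 0 ≤ -P.s k := by linarith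
      positivity
    have h2 : 0 < P.δ * P.s k ^ 2 := mul_pos P.δ_pos (by nlinarith)
    nlinarith [sq_nonneg (P.s (k + 1))]

theorem u_nonpos {k : ℕ} (h2 : 2 ≤ k) (hk : k ≤ P.n + 3) : P.u k ≤ 0 := by
  rcases hk.lt_or_eq with h | rfl
  · obtain ⟨j, rfl⟩ := Nat.exists_eq_add_of_le' h2
    exact (P.u_neg j (by omega)).le
  · exact P.u_end.le

/-- Increments stay positive, once they are nonnegative, up to the end of the chain. -/
theorem s_succ_pos {k : ℕ} (hk2 : 1 ≤ k) (hneg : P.s k < 0)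
    (h0 : 0 ≤ P.s (k + 1)) : ∀ j, k + 1 < j → j ≤ P.n + 3 → 0 < P.s j := by
  have hlast : 0 < P.s (P.n + 3) := by rw [s_last]; linarith [P.β_pos]
  rcases le_or_gt P.τ 0 with hτ | hτ
  · intro j hj1 hj2
    have hn := P.n_eq hτ
    have : j = P.n + 3 := by omega
    rw [this]; exact hlast
  have hδ := P.δ_pos
  rcases le_or_gt (4 * P.δ) (P.τ ^ 2) with hr | hc
  · set S := √(P.τ ^ 2 - 4 * P.δ) with hS
    have hS2 : S ^ 2 = P.τ ^ 2 - 4 * P.δ := Real.sq_sqrt (by linarith)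
    have hS0 : 0 ≤ S := Real.sqrt_nonneg _
    have hlt : S < P.τ := by nlinarith
    obtain ⟨l, hl⟩ : ∃ l, l = (P.τ + S) / 2 := ⟨_, rfl⟩
    obtain ⟨m, hm⟩ : ∃ m, m = (P.τ - S) / 2 := ⟨_, rfl⟩
    have hl0 : 0 < l := by rw [hl]; linarith
    have hm0 : 0 < m := by rw [hm]; linarith
    have hsum : P.τ = l + m := by rw [hl, hm]; ring
    have hprod : P.δ = l * m := by rw [hl, hm]; nlinarith
    -- Real positive eigenvalues l, m: removing the l-mode leaves a geometric sequence of ratio m,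
    -- which starts positive because s k < 0 ≤ s (k+1).
    have ht : ∀ i, 0 < P.s (k + i + 1) - l * P.s (k + i) := by
      intro i
      induction i with
      | zero => simpa using by nlinarith [mul_pos hl0 (neg_pos.mpr hneg)]
      | succ i ih =>
        have e := P.s_rec (k + i)
        have : P.s (k + i + 2) - l * P.s (k + i + 1) =
          m * (P.s (k + i + 1) - l * P.s (k + i)) := by rw [e, hsum, hprod]; ring
        have h2 := mul_pos hm0 ih
        rw [← this] at h2
        exact h2
    have hp : ∀ i, 0 < P.s (k + 1 + i + 1) := by
      intro i
      induction i with
      | zero =>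
        have := ht 1
        have := mul_nonneg hl0.le h0
        simp only [add_zero] at *
        linarith
      | succ i ih =>
        have h1 := ht (i + 2)
        have h2 := mul_pos hl0 ih
        rw [show k + (i + 2) = k + 1 + i + 1 by ring] at h1
        rw [show k + 1 + (i + 1) + 1 = k + 1 + i + 1 + 1 by ring]
        linarith
    intro j hj _
    obtain ⟨i, rfl⟩ := Nat.exists_eq_add_of_lt hj
    exact hp i
  · have hD : 0 < 1 - P.τ + P.δ := by nlinarith [sq_nonneg (P.τ - 2)]
    -- The first coordinate of the fixed point of the left half-map. It is positive for complex
    -- eigenvalues, so all deviations u - x along the chain are negative.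
    set x := 1 / (1 - P.τ + P.δ) with hx
    have hx0 : 0 < x := by positivity
    have hxe : x * (1 - P.τ + P.δ) = 1 := by rw [hx]; field_simp
    have step : ∀ j, 2 ≤ j → j ≤ P.n + 2 → 0 ≤ P.s j → 0 < P.s (j + 1) := by
      intro j hj1 hj2 hsj
      rcases hj2.lt_or_eq with hlt | rfl
      swap
      · exact hlast
      by_contra hcon
      have w0 : P.u j - x < 0 := by linarith [P.u_nonpos hj1 (by omega)]
      have w1 : P.u (j + 1) - x < 0 := by linarith [P.u_nonpos (k := j + 1) (by omega) (by omega)]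
      have w2 : P.u (j + 2) - x < 0 := by linarith [P.u_nonpos (k := j + 2) (by omega) (by omega)]
      have c1 : P.u j - x ≤ P.u (j + 1) - x := by simp only [s] at hsj; linarith
      have c2 : P.u (j + 2) - x ≤ P.u (j + 1) - x := by
        simp only [s, not_lt] at hcon
        rw [show j + 1 + 1 = j + 2 from rfl] at hcon
        linarith
      have hrec : P.u (j + 2) - x = P.τ * (P.u (j + 1) - x) - P.δ * (P.u j - x) := by
        rw [P.u_rec]; linarith
      set A := P.u j - x
      set B := P.u (j + 1) - x
      set C := P.u (j + 2) - x
      -- The middle of three negative deviations is the closest to zero. But B² - A C = B² - τ A B +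
      -- δ A² is positive definite for complex eigenvalues.
      have h1 : B ^ 2 ≤ A * C := by nlinarith
      have h2 : 0 < B ^ 2 - P.τ * (A * B) + P.δ * A ^ 2 := by
        have : B ^ 2 - P.τ * (A * B) + P.δ * A ^ 2 =
          (B - P.τ / 2 * A) ^ 2 + (P.δ - P.τ ^ 2 / 4) * A ^ 2 := by ring
        rw [this]
        have : 0 < (P.δ - P.τ ^ 2 / 4) * A ^ 2 := mul_pos (by linarith) (by nlinarith)
        nlinarith [sq_nonneg (B - P.τ / 2 * A)]
      rw [hrec] at h1
      nlinarith
    have hp : ∀ i, k + 1 + i ≤ P.n + 2 → 0 ≤ P.s (k + 1 + i) := by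
      intro i
      induction i with
      | zero => intro _; exact h0
      | succ i ih => intro h; exact (step _ (by omega) (by omega) (ih (by omega))).le
    intro j hj hjn
    obtain ⟨i, rfl⟩ := Nat.exists_eq_add_of_lt hj
    exact step _ (by omega) (by omega) (hp i (by omega))

/-- The increments change sign exactly once along the chain. -/
theorem exists_turn : ∃ k, 1 ≤ k ∧ k ≤ P.n + 1 ∧ (∀ j, 1 ≤ j → j ≤ k → P.s j < 0) ∧
    0 ≤ P.s (k + 1) ∧ ∀ j, k + 1 < j → j ≤ P.n + 3 → 0 < P.s j := by
  classical
  have hex : ∃ k, 0 ≤ P.s (k + 1) := ⟨P.n + 1, P.s_end_pos.le⟩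
  set k := Nat.find hex with hk
  have h1 : 0 ≤ P.s (k + 1) := Nat.find_spec hex
  have hlow : ∀ j, 1 ≤ j → j ≤ k → P.s j < 0 := by
    intro j hj1 hjk
    obtain ⟨i, rfl⟩ := Nat.exists_eq_add_of_le' hj1
    exact not_le.mp (Nat.find_min hex (Nat.lt_of_succ_le hjk))
  have hk1 : 1 ≤ k := by
    by_contra h
    have : k = 0 := by omega
    rw [this] at h1
    exact absurd h1 (not_le.mpr P.s_one_neg)
  have hkn : k ≤ P.n + 1 := Nat.find_min' hex P.s_end_pos.le
  exact ⟨k, hk1, hkn, hlow, h1, P.s_succ_pos hk1 (hlow k hk1 le_rfl) h1⟩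

/-- Line k passes through (u (k+1), -δ u k) and (u (k+2), -δ u (k+1)), and these points form an
orbit of the left half-map. -/
theorem g_succ (k : ℕ) (a b : ℝ) :
    P.g (k + 1) (P.τ * a + b + 1) (-P.δ * a) = P.δ * P.g k a b := by
  simp only [g]
  rw [P.s_rec k, show k + 1 + 1 = k + 2 from rfl, P.u_rec k]
  ring

theorem g_top (a b : ℝ) : P.g (P.n + 2) a b = P.β * (P.β + 1) - P.β * a - (P.β + 1) * b := by
  rw [g, show P.n + 2 + 1 = P.n + 3 from rfl, P.s_last, P.u_end, neg_mul, P.δ_mul_s]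
  linear_combination -(P.β + 1) * P.β_eq

theorem K_right (a b : ℝ) :
    P.K (P.τR * a + b + 1) (-P.δR * a) = P.δR * P.g (P.n + 2) a b := by
  rw [g_top, K]
  ring

/-- Lines k and k+1 meet at the vertex (u (k+2), -δ u (k+1)). Eliminating the first coordinate
leaves the height above this vertex; `g_elim'` eliminates the second. With `kap_pos` this transfers
signs between neighbouring edges. -/
theorem g_elim (k : ℕ) (a b : ℝ) : P.s (k + 1) * P.g k a b - P.s k * P.g (k + 1) a b =
    -P.kap k * (b + P.δ * P.u (k + 1)) := by
  simp only [g, kap, s]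
  ring

theorem g_elim' (k : ℕ) (a b : ℝ) : P.s (k + 2) * P.g k a b - P.s (k + 1) * P.g (k + 1) a b =
    P.δ * P.kap k * (a - P.u (k + 2)) := by
  simp only [g, kap, s]
  ring

/-- In the lower left quadrant all other edge lines are met only after the first one. -/
theorem g_pos_of_lower {a b : ℝ} (ha : a ≤ 0) (hb : b ≤ 0) (h1 : 0 < P.g 1 a b) :
    ∀ k, 1 ≤ k → k ≤ P.n + 1 → 0 < P.g k a b := by
  obtain ⟨t, ht1, htn, hneg, h0, hpos⟩ := P.exists_turn
  have hb' : ∀ k, 1 ≤ k → k ≤ P.n + 1 → P.kap k * (b + P.δ * P.u (k + 1)) < 0 := by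
    intro k hk1 hkn
    obtain ⟨i, rfl⟩ := Nat.exists_eq_add_of_le' hk1
    have := P.u_neg i (by omega)
    have h2 := mul_pos P.δ_pos (neg_pos.mpr this)
    exact mul_neg_of_pos_of_neg (P.kap_pos _) (by
      rw [show i + 1 + 1 = i + 2 from rfl]; linarith)
  -- Up to the turn the increments are negative, and `g_elim` carries positivity from one line to
  -- the next.
  have hasc : ∀ i, i + 1 ≤ t → 0 < P.g (i + 1) a b := by
    intro i
    induction i with
    | zero => intro _; exact h1
    | succ i ih =>
      intro hi
      have ih' := ih (by omega)
      have e := P.g_elim (i + 1) a b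
      have hs1 := hneg (i + 1) (by omega) (by omega)
      have hs2 := hneg (i + 2) (by omega) (by omega)
      have hk := hb' (i + 1) (by omega) (by omega)
      rw [show i + 1 + 1 = i + 2 from rfl] at *
      have : P.s (i + 1) * P.g (i + 2) a b < 0 := by
        have := mul_neg_of_neg_of_pos hs2 ih'
        linarith
      exact pos_of_mul_neg_right this hs1.le
  have htop : 0 < P.g (P.n + 2) a b := by
    rw [g_top]
    have := P.β_pos
    nlinarith [mul_pos this (by linarith : 0 < P.β + 1)]
  -- Beyond the turn positivity is carried backwards, from line n+2, which has the whole closed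
  -- quadrant on its positive side.
  have hdesc : ∀ i, i ≤ P.n + 1 - t → 0 < P.g (P.n + 2 - i) a b := by
    intro i
    induction i with
    | zero => intro _; exact htop
    | succ i ih =>
      intro hi
      have ih' := ih (by omega)
      obtain ⟨k, hk⟩ : ∃ k, k = P.n + 2 - (i + 1) := ⟨_, rfl⟩
      rw [show P.n + 2 - i = k + 1 by omega] at ih'
      rw [← hk]
      have e := P.g_elim k a b
      have hs1 : 0 ≤ P.s k := by
        rcases (show t + 1 ≤ k by omega).eq_or_lt with h | h
        · rw [← h]; exact h0
        · exact (hpos k h (by omega)).le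
      have hs2 := hpos (k + 1) (by omega) (by omega)
      have hk' := hb' k (by omega) (by omega)
      have : 0 < P.s (k + 1) * P.g k a b := by
        have := mul_nonneg hs1 ih'.le
        linarith
      exact pos_of_mul_pos_right this hs2.le
  intro k hk1 hkn
  rcases le_or_gt k t with h | h
  · obtain ⟨i, rfl⟩ := Nat.exists_eq_add_of_le' hk1
    exact hasc i h
  · have := hdesc (P.n + 2 - k) (by omega)
    rwa [show P.n + 2 - (P.n + 2 - k) = k by omega] at this

theorem g_one_origin_pos : 0 < P.g 1 0 0 := by
  have h2 := P.u_neg 0 (Nat.zero_le _)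
  have h3 : P.u 3 ≤ 0 := P.u_nonpos (by norm_num) (by omega)
  have h1 := P.u_one
  have e : P.g 1 0 0 = P.δ * (P.u 2 ^ 2 - P.u 1 * P.u 3) := by simp only [g, s]; ring
  rw [e]
  simp only [zero_add] at h2
  exact mul_pos P.δ_pos (by nlinarith)

theorem g_zero_neg_one_pos : 0 < P.g 0 0 (-1) := by
  have e := P.g_succ 0 0 (-1)
  have h := P.g_one_origin_pos
  norm_num at e
  rw [e] at h
  exact pos_of_mul_pos_right h P.δ_pos.le

theorem g_zero_vertical (b : ℝ) : P.g 0 0 b = P.g 0 0 (-1) - P.s 1 * (b + 1) := by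
  simp only [g]; ring

theorem g_zero_origin_pos : 0 < P.g 0 0 0 := by
  rw [g_zero_vertical]
  linarith [P.g_zero_neg_one_pos, P.s_one_neg]

theorem g_zero_pos_of_upper {a b : ℝ} (ha : a ≤ 0) (hb : 0 ≤ b) (h1 : 0 ≤ P.g 1 a b)
    (h : 0 < b ∨ 0 < P.g 1 a b) : 0 < P.g 0 a b := by
  have hs1 := P.s_one_neg
  rcases le_or_gt 0 (P.s 0) with h0 | h0
  · have e : P.g 0 a b = P.g 0 0 0 + P.δ * P.s 0 * (-a) + (-P.s 1) * b := by
      simp only [g]; ring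
    rw [e]
    have := P.g_zero_origin_pos
    have := P.δ_pos
    have : 0 ≤ P.δ * P.s 0 * (-a) := mul_nonneg (by positivity) (by linarith)
    have : 0 ≤ (-P.s 1) * b := mul_nonneg (by linarith) hb
    linarith
  · have e := P.g_elim 0 a b
    simp only [zero_add] at e
    have hk := P.kap_pos 0
    have hu : 0 ≤ P.δ * P.u 1 := mul_nonneg P.δ_pos.le P.u_one
    have : P.s 1 * P.g 0 a b < 0 := by
      have e' : P.s 1 * P.g 0 a b = P.s 0 * P.g 1 a b - P.kap 0 * (b + P.δ * P.u 1) := by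
        linarith
      rw [e']
      rcases h with h | h
      · have := mul_nonpos_of_nonpos_of_nonneg h0.le h1
        have := mul_pos hk (by linarith : 0 < b + P.δ * P.u 1)
        linarith
      · have := mul_neg_of_neg_of_pos h0 h
        have := mul_nonneg hk.le (by linarith : 0 ≤ b + P.δ * P.u 1)
        linarith
    exact pos_of_mul_neg_right this hs1.le

theorem K_slope_pos : 0 < P.β - P.τR * (P.β + 1) := by
  have := P.β_pos
  have := P.τR_lt
  nlinarith

theorem Y2_mul : P.Y2 * (P.β - P.τR * (P.β + 1)) = -P.δR * (P.β + 1) ^ 2 :=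
  div_mul_cancel₀ _ P.K_slope_pos.ne'

theorem Y2_neg : P.Y2 < 0 := by
  have h := P.Y2_mul
  have h1 := P.K_slope_pos
  have h2 : 0 < P.δR * (P.β + 1) ^ 2 := mul_pos P.δR_pos (by nlinarith [P.β_pos])
  by_contra hcon
  have := mul_nonneg (not_lt.mp hcon) h1.le
  linarith

theorem K_vertical (b : ℝ) : P.K 0 b = (P.β - P.τR * (P.β + 1)) * (b - P.Y2) := by
  have := P.Y2_mul
  simp only [K]
  linear_combination this

theorem K_nonneg_of_upper {a b : ℝ} (hb : 0 ≤ b) (h : 0 ≤ P.g (P.n + 2) a b) :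
    0 ≤ P.K a b ∧ (0 < P.g (P.n + 2) a b → 0 < P.K a b) := by
  rw [g_top] at *
  have hβ := P.β_pos
  have e : P.K a b = P.δR * (P.β + 1) * (P.β + 1 - a) + (P.β - P.τR * (P.β + 1)) * b := by
    simp only [K]; ring
  have h1 : 0 < P.δR * (P.β + 1) := mul_pos P.δR_pos (by linarith)
  have h2 : 0 ≤ (P.β - P.τR * (P.β + 1)) * b := mul_nonneg P.K_slope_pos.le hb
  have h3 : 0 ≤ (P.β + 1) * b := mul_nonneg (by linarith) hb
  rw [e]
  constructor
  · have : 0 ≤ P.β + 1 - a := by nlinarith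
    have := mul_nonneg h1.le this
    linarith
  · intro h
    have : 0 < P.β + 1 - a := by nlinarith
    have := mul_pos h1 this
    linarith

theorem g_top_nonneg_of_lower {a b : ℝ} (hb : b ≤ 0) (h : 0 ≤ P.K a b) :
    0 ≤ P.g (P.n + 2) a b ∧ (b < 0 → 0 < P.g (P.n + 2) a b) := by
  have e : P.K a b = P.δR * (P.β + 1) * (P.β + 1 - a) + (P.β - P.τR * (P.β + 1)) * b := by
    simp only [K]; ring
  rw [e] at h
  have hβ := P.β_pos
  have h1 : 0 < P.δR * (P.β + 1) := mul_pos P.δR_pos (by linarith)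
  have h2 : (P.β - P.τR * (P.β + 1)) * b ≤ 0 :=
    mul_nonpos_of_nonneg_of_nonpos P.K_slope_pos.le hb
  have h3 : 0 ≤ P.β + 1 - a := nonneg_of_mul_nonneg_right (by linarith) h1
  have h4 := mul_nonneg hβ.le h3
  have h5 : (P.β + 1) * b ≤ 0 := mul_nonpos_of_nonneg_of_nonpos (by linarith) hb
  rw [g_top]
  refine ⟨by linarith, fun hb => ?_⟩
  have : (P.β + 1) * b < 0 := mul_neg_of_pos_of_neg (by linarith) hb
  linarith

/-- The right part of the polygon is the triangle with vertices `X`, `f X` and `Y`. -/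
theorem exists_barycentric {a b : ℝ} (ha : 0 ≤ a) (hg : 0 ≤ P.g (P.n + 2) a b)
    (hK : 0 ≤ P.K a b) : ∃ x y z : ℝ, 0 ≤ x ∧ 0 ≤ y ∧ 0 ≤ z ∧ x + y + z = 1 ∧
      a = y * (P.β + 1) ∧ b = x * P.β + z * P.Y2 := by
  have hβ := P.β_pos
  have hE := P.K_slope_pos
  have hY := P.Y2_neg
  have hY' := P.Y2_mul
  have hd : 0 < P.β - P.Y2 := by linarith
  have eK : P.K a b = (P.β - P.τR * (P.β + 1)) * (b - P.Y2 + P.Y2 * (a / (P.β + 1))) := by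
    simp only [K]
    field_simp
    linear_combination (P.β + 1 - a) * hY'
  have eg : P.g (P.n + 2) a b = (P.β + 1) * (P.β - b - P.β * (a / (P.β + 1))) := by
    rw [g_top]; field_simp; ring
  rw [eK] at hK
  rw [eg] at hg
  have h1 := nonneg_of_mul_nonneg_right hK hE
  have h2 := nonneg_of_mul_nonneg_right hg (by linarith : 0 < P.β + 1)
  refine ⟨(b - P.Y2 + P.Y2 * (a / (P.β + 1))) / (P.β - P.Y2), a / (P.β + 1),
    (P.β - b - P.β * (a / (P.β + 1))) / (P.β - P.Y2), by positivity, by positivity, by positivity,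
    ?_, ?_, ?_⟩
  · field_simp; ring
  · field_simp
  · field_simp; ring

/-- An affine function that is positive at the vertices of the left part of the image of the right
triangle is positive on it. -/
theorem affine_pos_of_right {φ : ℝ → ℝ → ℝ} {p q r : ℝ} (hφ : ∀ a b, φ a b = p * a + q * b + r)
    (hO : 0 < φ 0 0) (hY : 0 < φ 0 P.Y2)
    (hZ : 0 < φ (P.τR * (P.β + 1) + 1) (-P.δR * (P.β + 1)))
    (hfY : P.Y2 + 1 ≤ 0 → 0 < φ (P.Y2 + 1) 0) {a b : ℝ} (ha : 0 ≤ a)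
    (hg : 0 ≤ P.g (P.n + 2) a b) (hK : 0 ≤ P.K a b) (h1 : P.τR * a + b + 1 ≤ 0) :
    0 < φ (P.τR * a + b + 1) (-P.δR * a) := by
  obtain ⟨x, y, z, hx, hy, hz, hsum, rfl, rfl⟩ := P.exists_barycentric ha hg hK
  have hβ := P.β_pos
  have hE := P.K_slope_pos
  have hY0 := P.Y2_neg
  have hY' := P.Y2_mul
  have hB : 0 < P.β + 1 := by linarith
  -- A Lagrange multiplier for the constraint that the image point has nonpositive first coordinate:
  -- φ plus μ times that coordinate is controlled at the vertices f(X), Z, f(Y) of the image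
  -- triangle, and φ is at least this sum on the left.
  obtain ⟨μ, hμ, c1, c2, c3⟩ : ∃ μ : ℝ, 0 ≤ μ ∧ 0 ≤ φ (P.β + 1) 0 + μ * (P.β + 1) ∧
      0 < φ (P.τR * (P.β + 1) + 1) (-P.δR * (P.β + 1)) + μ * (P.τR * (P.β + 1) + 1) ∧
      0 < φ (P.Y2 + 1) 0 + μ * (P.Y2 + 1) := by
    have comb : ∀ ν : ℝ, (P.β + 1) * (φ (P.Y2 + 1) 0 + ν * (P.Y2 + 1)) =
        (P.Y2 + 1) * (φ (P.β + 1) 0 + ν * (P.β + 1)) + (P.β - P.Y2) * φ 0 0 := by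
      intro ν; simp only [hφ]; ring
    have hOm : 0 < (P.β - P.Y2) * φ 0 0 := mul_pos (by linarith) hO
    rcases le_or_gt 0 (φ (P.β + 1) 0) with h | h
    · refine ⟨0, le_rfl, by simpa using h, by simpa using hZ, ?_⟩
      rcases le_or_gt (P.Y2 + 1) 0 with h' | h'
      · simpa using hfY h'
      · have e := comb 0
        have := mul_nonneg h'.le h
        refine pos_of_mul_pos_right (a := P.β + 1) ?_ hB.le
        rw [e]
        simp only [zero_mul, add_zero]
        linarith
    -- This μ makes the sum vanish at f(X) without changing φ on the switching line. Positivity at Y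
    -- and at the origin then spreads along lines through f(X) to Z and f(Y).
    · have e0 : φ (P.β + 1) 0 + -φ (P.β + 1) 0 / (P.β + 1) * (P.β + 1) = 0 := by field_simp; ring
      refine ⟨-φ (P.β + 1) 0 / (P.β + 1), by
        exact div_nonneg (by linarith) hB.le, e0.ge, ?_, ?_⟩
      · have e : (P.β - P.τR * (P.β + 1)) * φ 0 P.Y2 =
            (P.β + 1) * (φ (P.τR * (P.β + 1) + 1) (-P.δR * (P.β + 1)) +
              -φ (P.β + 1) 0 / (P.β + 1) * (P.τR * (P.β + 1) + 1)) := by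
          field_simp
          simp only [hφ]
          linear_combination q * hY'
        have := mul_pos hE hY
        rw [e] at this
        exact pos_of_mul_pos_right this hB.le
      · refine pos_of_mul_pos_right (a := P.β + 1) ?_ hB.le
        rw [comb, e0]
        linarith
  have key : φ (P.τR * (y * (P.β + 1)) + (x * P.β + z * P.Y2) + 1) (-P.δR * (y * (P.β + 1))) +
      μ * (P.τR * (y * (P.β + 1)) + (x * P.β + z * P.Y2) + 1) =
      x * (φ (P.β + 1) 0 + μ * (P.β + 1)) +
      y * (φ (P.τR * (P.β + 1) + 1) (-P.δR * (P.β + 1)) + μ * (P.τR * (P.β + 1) + 1)) +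
      z * (φ (P.Y2 + 1) 0 + μ * (P.Y2 + 1)) := by
    simp only [hφ]
    linear_combination (-(p + μ) - r) * hsum
  have hneg := mul_nonpos_of_nonneg_of_nonpos hμ h1
  -- The sum may vanish at f(X), but f(X) itself lies on the right, so another vertex has positive
  -- weight.
  have hyz : 0 < y ∨ 0 < z := by
    by_contra! hcon
    have hy0 : y = 0 := le_antisymm hcon.1 hy
    have hz0 : z = 0 := le_antisymm hcon.2 hz
    have hx1 : x = 1 := by linarith
    rw [hy0, hz0, hx1] at h1
    linarith
  have t1 := mul_nonneg hx c1
  rcases hyz with h | h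
  · have := mul_pos h c2
    have := mul_nonneg hz c3.le
    linarith
  · have := mul_pos h c3
    have := mul_nonneg hy c2.le
    linarith

/-- The left part of the polygon is bounded. -/
theorem exists_bound : ∃ B : ℝ, ∀ a b : ℝ, a ≤ 0 → (∀ k ≤ P.n + 1, 0 ≤ P.g k a b) →
    |a| ≤ B ∧ |b| ≤ B := by
  obtain ⟨t, ht1, htn, hneg, h0, -⟩ := P.exists_turn
  obtain ⟨i, rfl⟩ := Nat.exists_eq_add_of_le' ht1
  -- The two edges at the turn confine the region to the right of their common vertex.
  have hA : ∀ a b : ℝ, (∀ k ≤ P.n + 1, 0 ≤ P.g k a b) → P.u (i + 2) ≤ a := by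
    intro a b hg
    have e := P.g_elim' i a b
    have h1 := mul_nonneg h0 (hg i (by omega))
    have h2 := mul_nonpos_of_nonpos_of_nonneg (hneg (i + 1) (by omega) le_rfl).le
      (hg (i + 1) (by omega))
    have h3 : 0 ≤ P.δ * P.kap i * (a - P.u (i + 2)) := by
      rw [← e]
      rw [show i + 1 + 1 = i + 2 from rfl] at h1
      linarith
    have := nonneg_of_mul_nonneg_right h3 (mul_pos P.δ_pos (P.kap_pos i))
    linarith
  have hs1 := P.s_one_neg
  have hs2 := P.s_end_pos
  set A := |P.u (i + 2)| with hAdef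
  set L := (P.δ * |P.s 0| * (A + |P.u 1|)) / (-P.s 1) + |P.δ * P.u 0| with hL
  set U := (P.δ * |P.s (P.n + 1)| * (A + |P.u (P.n + 2)|)) / P.s (P.n + 2) +
    |P.δ * P.u (P.n + 1)| with hU
  have hL0 : 0 ≤ L := by
    have := P.δ_pos
    have h3 : 0 < -P.s 1 := by linarith
    positivity
  have hU0 : 0 ≤ U := by have := P.δ_pos; positivity
  refine ⟨A + L + U, fun a b ha hg => ?_⟩
  have ha' : |a| ≤ A := by
    have h1 := hA a b hg
    rw [abs_of_nonpos ha, hAdef]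
    have := neg_abs_le (P.u (i + 2))
    linarith
  have hlin : ∀ k, |P.δ * P.s k * (a - P.u (k + 1))| ≤ P.δ * |P.s k| * (A + |P.u (k + 1)|) := by
    intro k
    rw [abs_mul, abs_mul, abs_of_pos P.δ_pos]
    have := P.δ_pos
    gcongr
    exact (abs_sub _ _).trans (by linarith)
  refine ⟨by linarith, abs_le.mpr ⟨?_, ?_⟩⟩
  · have h1 := hg 0 (by omega)
    simp only [g, zero_add] at h1
    have h2 := (abs_le.mp (hlin 0)).1
    simp only [zero_add] at h2
    have h3 : -(P.δ * |P.s 0| * (A + |P.u 1|)) / (-P.s 1) ≤ b + P.δ * P.u 0 := by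
      rw [div_le_iff₀ (by linarith)]
      have h4 := (abs_le.mp (hlin 0)).2
      simp only [zero_add] at h4
      linarith
    have h5 := le_abs_self (P.δ * P.u 0)
    rw [neg_div] at h3
    have : 0 ≤ A := abs_nonneg _
    linarith
  · have h1 := hg (P.n + 1) le_rfl
    simp only [g] at h1
    have h2 := (abs_le.mp (hlin (P.n + 1))).1
    have h3 : b + P.δ * P.u (P.n + 1) ≤
        (P.δ * |P.s (P.n + 1)| * (A + |P.u (P.n + 2)|)) / P.s (P.n + 2) := by
      rw [le_div_iff₀ hs2]
      rw [show P.n + 1 + 1 = P.n + 2 from rfl] at *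
      linarith
    have h5 := neg_abs_le (P.δ * P.u (P.n + 1))
    have : 0 ≤ A := abs_nonneg _
    linarith

/-- A linear function that increases by at least a fixed amount along each step of the left
half-map inside the left part of the polygon. -/
theorem exists_drift : ∃ c₁ c₂ ε : ℝ, 0 < ε ∧ ∀ a b : ℝ, a ≤ 0 → 0 ≤ P.g 0 a b →
    c₁ * a + c₂ * b + ε ≤ c₁ * (P.τ * a + b + 1) + c₂ * (-P.δ * a) := by
  rcases le_or_gt 0 (1 - P.τ + P.δ) with hD | hD
  · refine ⟨1, 1, 1, one_pos, fun a b ha _ => ?_⟩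
    nlinarith [mul_nonneg hD (neg_nonneg.mpr ha)]
  · have hk := P.kap_pos 0
    -- The coefficients are chosen so that the increment per step is exactly ε + `g 0`. At the fixed
    -- point the increment is zero, so -ε is the value of `g 0` there.
    obtain ⟨c, hc⟩ : ∃ c, c * (1 - P.τ + P.δ) = P.δ * P.s 0 - P.δ * P.s 1 :=
      ⟨(P.δ * P.s 0 - P.δ * P.s 1) / (1 - P.τ + P.δ), div_mul_cancel₀ _ hD.ne⟩
    refine ⟨c, c + P.s 1, P.δ * P.kap 0 / (-(1 - P.τ + P.δ)),
      div_pos (mul_pos P.δ_pos hk) (by linarith), fun a b ha hg => ?_⟩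
    obtain ⟨e, he⟩ : ∃ e, P.δ * P.kap 0 / (-(1 - P.τ + P.δ)) = e := ⟨_, rfl⟩
    rw [he]
    rw [div_eq_iff (by linarith)] at he
    have key : c * (P.τ * a + b + 1) + (c + P.s 1) * (-P.δ * a) - (c * a + (c + P.s 1) * b) - e =
        P.g 0 a b := by
      apply mul_left_cancel₀ hD.ne
      simp only [kap, g, s] at *
      rw [show (0 : ℕ) + 1 + 1 = 0 + 2 from rfl, show (0 : ℕ) + 2 + 1 = 0 + 1 + 2 from rfl,
        P.u_rec (0 + 1), show (0 : ℕ) + 1 + 1 = 0 + 2 from rfl, P.u_rec 0] at *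
      simp only [zero_add] at *
      linear_combination (1 - a * (1 - P.τ + P.δ)) * hc - he
    linarith

end PolygonData

/-! ### Continuity, and escape from the left half-plane -/

namespace BCParams

variable (q : BCParams)

theorem f_of_nonpos {x : Plane} (hx : x 0 ≤ 0) : q.f x = q.fL x := if_pos hx

theorem fL_zero (x : Plane) : q.fL x 0 = q.τL * x 0 + x 1 + 1 := halfMap_zero _ _ x

theorem fL_one (x : Plane) : q.fL x 1 = -q.δL * x 0 := halfMap_one _ _ x

theorem fR_zero (x : Plane) : q.fR x 0 = q.τR * x 0 + x 1 + 1 := halfMap_zero _ _ x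

theorem fR_one (x : Plane) : q.fR x 1 = -q.δR * x 0 := halfMap_one _ _ x

theorem continuous_halfMap (τ δ : ℝ) : Continuous (halfMap τ δ) :=
  (LinearMap.continuous_of_finiteDimensional _).add continuous_const

theorem continuous_f : Continuous q.f := by
  refine Continuous.if_le (continuous_halfMap _ _) (continuous_halfMap _ _) (by fun_prop)
    continuous_const fun x hx => ?_
  have h1 := q.f_of_nonneg x hx.ge
  rwa [q.f_of_nonpos hx.le] at h1

theorem exists_affine_iterate_fL (i : ℕ) :
    ∃ a b c : ℝ, ∀ x : Plane, (q.fL^[i] x) 0 = a * x 0 + b * x 1 + c := by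
  induction i with
  | zero => exact ⟨1, 0, 0, fun x => by simp⟩
  | succ i ih =>
    obtain ⟨a, b, c, h⟩ := ih
    refine ⟨a * q.τL - b * q.δL, a, a + c, fun x => ?_⟩
    rw [Function.iterate_succ_apply, h, fL_zero, fL_one]
    ring

/-- If some point stays in the left half-plane for `p` steps of the left half-map, then all points
of the left half-plane that are there after `p` steps have been there in between. -/
theorem iterate_fL_nonpos (hL : 0 < q.δL) {p : ℕ} (hp : 1 ≤ p) : ∀ x : Plane,
    (∀ i ≤ p, (q.fL^[i] x) 0 ≤ 0) → ∀ z : Plane, z 0 ≤ 0 → (q.fL^[p] z) 0 ≤ 0 →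
    ∀ i ≤ p, (q.fL^[i] z) 0 ≤ 0 := by
  induction p, hp using Nat.le_induction with
  | base =>
    intro x _ z hz hz1 i hi
    interval_cases i
    · exact hz
    · exact hz1
  | succ p hp ih =>
    intro x hx z hz hz1
    have hx' : ∀ i ≤ p, (q.fL^[i] x) 0 ≤ 0 := fun i hi => hx i (by omega)
    suffices h : (q.fL^[p] z) 0 ≤ 0 by
      intro i hi
      rcases hi.lt_or_eq with h' | rfl
      · exact ih x hx' z hz h i (by omega)
      · exact hz1
    by_contra! hcon
    have hxp := hx' p le_rfl
    -- The point w between x and z hits the switching line after p steps, coming from the left; its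
    -- next first coordinate is then at least 1. Convexity makes it nonpositive.
    obtain ⟨t, ht0, ht1, ht⟩ : ∃ t : ℝ, 0 ≤ t ∧ t ≤ 1 ∧
        (1 - t) * (q.fL^[p] x) 0 + t * (q.fL^[p] z) 0 = 0 := by
      refine ⟨-(q.fL^[p] x) 0 / ((q.fL^[p] z) 0 - (q.fL^[p] x) 0),
        div_nonneg (by linarith) (by linarith), ?_, ?_⟩
      · rw [div_le_one (by linarith)]; linarith
      · have : (q.fL^[p] z) 0 - (q.fL^[p] x) 0 ≠ 0 := by linarith
        field_simp
        ring
    have hconv : ∀ i, (q.fL^[i] ((1 - t) • x + t • z)) 0 =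
        (1 - t) * (q.fL^[i] x) 0 + t * (q.fL^[i] z) 0 := by
      intro i
      obtain ⟨a, b, c, h⟩ := q.exists_affine_iterate_fL i
      simp only [h, PiLp.add_apply, PiLp.smul_apply, smul_eq_mul]
      ring
    have hle : ∀ i, (q.fL^[i] x) 0 ≤ 0 → (q.fL^[i] z) 0 ≤ 0 →
        (q.fL^[i] ((1 - t) • x + t • z)) 0 ≤ 0 := by
      intro i h1 h2
      rw [hconv]
      have := mul_nonpos_of_nonneg_of_nonpos (by linarith : 0 ≤ 1 - t) h1
      have := mul_nonpos_of_nonneg_of_nonpos ht0 h2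
      linarith
    set w := (1 - t) • x + t • z with hw
    have hw0 : (q.fL^[p] w) 0 = 0 := by rw [hconv]; exact ht
    have hwi := ih x hx' w (hle 0 (hx 0 (by omega)) hz) hw0.le
    have hw1 := hle (p + 1) (hx _ le_rfl) hz1
    obtain ⟨i, rfl⟩ := Nat.exists_eq_add_of_le' hp
    rw [Function.iterate_succ_apply', fL_zero, hw0, Function.iterate_succ_apply', fL_one] at hw1
    have := hwi i (by omega)
    have := mul_nonpos_of_nonneg_of_nonpos hL.le this
    linarith

theorem exists_of_chiL_le {x : Plane} {p : ℕ} (h : q.chiL x ≤ p) :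
    ∃ i, 1 ≤ i ∧ i ≤ p ∧ 0 < (q.fL^[i] x) 0 := by
  unfold chiL at h
  rcases ((fun i : ℕ => (i : ℕ∞)) '' {p : ℕ | 1 ≤ p ∧ 0 < (q.fL^[p] x) 0}).eq_empty_or_nonempty
    with h' | h'
  · rw [h', sInf_empty] at h
    simp at h
  · obtain ⟨i, ⟨hi1, hi2⟩, hi⟩ := csInf_mem h'
    refine ⟨i, hi1, ?_, hi2⟩
    rw [← hi] at h
    exact Nat.cast_le.mp h

end BCParams

/-! ### Invariance and eventual absorption of the polygon -/

namespace PolygonData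

variable (P : PolygonData)

/-- The parameters of the normal form. -/
def params : BCParams := ⟨P.τ, P.δ, P.τR, P.δR⟩

/-- The forward invariant polygon. -/
def polygon : Set Plane :=
  {x | x 0 ≤ 0 ∧ ∀ k ≤ P.n + 1, 0 ≤ P.g k (x 0) (x 1)} ∪
    {x | 0 ≤ x 0 ∧ 0 ≤ P.g (P.n + 2) (x 0) (x 1) ∧ 0 ≤ P.K (x 0) (x 1)}

/-- The points that satisfy the constraints of both parts of the polygon that apply to them, the
constraints of index below `m` strictly. -/
def StrictBelow (m : ℕ) (x : Plane) : Prop :=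
  (x 0 ≤ 0 → ∀ k ≤ P.n + 1,
    0 ≤ P.g k (x 0) (x 1) ∧ (k < m → 0 < P.g k (x 0) (x 1))) ∧
  (0 ≤ x 0 → 0 ≤ P.g (P.n + 2) (x 0) (x 1) ∧ 0 ≤ P.K (x 0) (x 1) ∧
    (P.n + 2 < m → 0 < P.g (P.n + 2) (x 0) (x 1)) ∧ (P.n + 3 < m → 0 < P.K (x 0) (x 1)))

/-- The tests on the points `Y` and `Z`. -/
structure Admissible : Prop where
  Y_above : 0 < P.g 0 0 P.Y2
  Z_above : 0 < P.g 0 (P.τR * (P.β + 1) + 1) (-P.δR * (P.β + 1))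
  Z_right : 0 < P.g 1 (P.τR * (P.β + 1) + 1) (-P.δR * (P.β + 1))

variable {P}

theorem StrictBelow.mem_polygon {m : ℕ} {x : Plane} (h : P.StrictBelow m x) : x ∈ P.polygon := by
  rcases le_total (x 0) 0 with h0 | h0
  · exact Or.inl ⟨h0, fun k hk => (h.1 h0 k hk).1⟩
  · exact Or.inr ⟨h0, (h.2 h0).1, (h.2 h0).2.1⟩

theorem Admissible.g_one_pos (hP : P.Admissible) {a b : ℝ} (ha : 0 ≤ a)
    (hg : 0 ≤ P.g (P.n + 2) a b) (hK : 0 ≤ P.K a b) (h1 : P.τR * a + b + 1 ≤ 0) :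
    0 < P.g 1 (P.τR * a + b + 1) (-P.δR * a) := by
  have hlin : ∀ a b, P.g 1 a b = (-P.δ * P.s 1) * a + (-P.s 2) * b + P.g 1 0 0 := by
    intro a b; simp only [g]; ring
  have hβ := P.β_pos
  refine P.affine_pos_of_right hlin P.g_one_origin_pos ?_ hP.Z_right (fun _ => ?_) ha hg hK h1
  · have hfX : 0 < P.g 1 (P.β + 1) 0 := by
      rw [hlin]
      have := P.g_one_origin_pos
      have := mul_pos P.δ_pos (neg_pos.mpr P.s_one_neg)
      nlinarith
    have e : (P.β - P.τR * (P.β + 1)) * P.g 1 0 P.Y2 =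
        -(P.τR * (P.β + 1) + 1) * P.g 1 (P.β + 1) 0 +
        (P.β + 1) * P.g 1 (P.τR * (P.β + 1) + 1) (-P.δR * (P.β + 1)) := by
      rw [hlin 0, hlin (P.β + 1), hlin (P.τR * (P.β + 1) + 1)]
      linear_combination (-P.s 2) * P.Y2_mul
    have h2 : 0 < -(P.τR * (P.β + 1) + 1) := by nlinarith [P.τR_lt]
    have h3 := mul_pos h2 hfX
    have h4 := mul_pos (by linarith : 0 < P.β + 1) hP.Z_right
    refine pos_of_mul_pos_right (a := P.β - P.τR * (P.β + 1)) ?_ P.K_slope_pos.le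
    rw [e]; linarith
  · have e := P.g_succ 0 0 P.Y2
    simp only [mul_zero, zero_add] at e
    rw [e]
    exact mul_pos P.δ_pos hP.Y_above

theorem Admissible.g_zero_pos (hP : P.Admissible) {a b : ℝ} (ha : 0 ≤ a)
    (hg : 0 ≤ P.g (P.n + 2) a b) (hK : 0 ≤ P.K a b) (h1 : P.τR * a + b + 1 ≤ 0) :
    0 < P.g 0 (P.τR * a + b + 1) (-P.δR * a) := by
  have hlin : ∀ a b, P.g 0 a b = (-P.δ * P.s 0) * a + (-P.s 1) * b + P.g 0 0 0 := by
    intro a b; simp only [g]; ring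
  refine P.affine_pos_of_right hlin P.g_zero_origin_pos hP.Y_above hP.Z_above (fun h => ?_)
    ha hg hK h1
  have e := P.g_succ 0 0 P.Y2
  simp only [mul_zero, zero_add] at e
  have h2 : 0 < P.g 1 (P.Y2 + 1) 0 := by
    rw [e]; exact mul_pos P.δ_pos hP.Y_above
  exact P.g_zero_pos_of_upper h le_rfl h2.le (Or.inr h2)

theorem f_left {x : Plane} (hx : x 0 ≤ 0) :
    P.params.f x 0 = P.τ * x 0 + x 1 + 1 ∧ P.params.f x 1 = -P.δ * x 0 := by
  rw [BCParams.f_of_nonpos _ hx]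
  exact ⟨BCParams.fL_zero _ x, BCParams.fL_one _ x⟩

theorem f_right {x : Plane} (hx : 0 ≤ x 0) :
    P.params.f x 0 = P.τR * x 0 + x 1 + 1 ∧ P.params.f x 1 = -P.δR * x 0 := by
  rw [BCParams.f_of_nonneg _ _ hx]
  exact ⟨BCParams.fR_zero _ x, BCParams.fR_one _ x⟩

theorem Admissible.strictBelow_of_right (hP : P.Admissible) {x : Plane} (h0 : 0 ≤ x 0)
    (hg : 0 ≤ P.g (P.n + 2) (x 0) (x 1)) (hK : 0 ≤ P.K (x 0) (x 1)) :
    (P.params.f x 0 ≤ 0 → ∀ k ≤ P.n + 1, 0 < P.g k (P.params.f x 0) (P.params.f x 1)) ∧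
    (0 ≤ P.params.f x 0 → 0 ≤ P.g (P.n + 2) (P.params.f x 0) (P.params.f x 1) ∧
      (0 < x 0 → 0 < P.g (P.n + 2) (P.params.f x 0) (P.params.f x 1))) ∧
    P.K (P.params.f x 0) (P.params.f x 1) = P.δR * P.g (P.n + 2) (x 0) (x 1) := by
  rw [(f_right h0).1, (f_right h0).2]
  have hδ := P.δR_pos
  have hb : -P.δR * x 0 ≤ 0 := by nlinarith
  refine ⟨fun h1 k hk => ?_, fun _ => ?_, P.K_right _ _⟩
  · rcases Nat.eq_zero_or_pos k with rfl | hk1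
    · exact hP.g_zero_pos h0 hg hK h1
    · exact P.g_pos_of_lower h1 hb (hP.g_one_pos h0 hg hK h1) k hk1 hk
  · have hK' : 0 ≤ P.K (P.τR * x 0 + x 1 + 1) (-P.δR * x 0) := by
      rw [P.K_right]; exact mul_nonneg hδ.le hg
    obtain ⟨h1, h2⟩ := P.g_top_nonneg_of_lower hb hK'
    exact ⟨h1, fun hx => h2 (by nlinarith)⟩

theorem g_zero_f_left {x : Plane} (h0 : x 0 ≤ 0)
    (hg : ∀ k ≤ P.n + 1, 0 ≤ P.g k (x 0) (x 1)) (h1 : P.params.f x 0 ≤ 0)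
    (h : 0 < P.params.f x 1 ∨ 0 < P.g 0 (x 0) (x 1)) :
    0 < P.g 0 (P.params.f x 0) (P.params.f x 1) := by
  rw [(f_left h0).1, (f_left h0).2] at *
  have hb : 0 ≤ -P.δ * x 0 := by nlinarith [P.δ_pos]
  have e := P.g_succ 0 (x 0) (x 1)
  simp only [zero_add] at e
  refine P.g_zero_pos_of_upper h1 hb ?_ (h.imp_right fun h => ?_)
  · rw [e]; exact mul_nonneg P.δ_pos.le (hg 0 (by omega))
  · rw [e]; exact mul_pos P.δ_pos h

theorem g_zero_f_left_nonneg {x : Plane} (h0 : x 0 ≤ 0)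
    (hg : ∀ k ≤ P.n + 1, 0 ≤ P.g k (x 0) (x 1)) (h1 : P.params.f x 0 ≤ 0) :
    0 ≤ P.g 0 (P.params.f x 0) (P.params.f x 1) := by
  by_cases h : 0 < P.params.f x 1 ∨ 0 < P.g 0 (x 0) (x 1)
  · exact (g_zero_f_left h0 hg h1 h).le
  · push Not at h
    have hx1 : 0 ≤ P.params.f x 1 := by rw [(f_left h0).2]; nlinarith [P.δ_pos]
    have hx1' := le_antisymm h.1 hx1
    have hg0 := le_antisymm h.2 (hg 0 (by omega))
    have e := P.g_succ 0 (x 0) (x 1)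
    rw [← (f_left h0).1, ← (f_left h0).2, hg0, mul_zero, zero_add] at e
    have e2 := P.g_elim 0 (P.params.f x 0) (P.params.f x 1)
    simp only [zero_add] at e2
    rw [e, hx1', mul_zero, sub_zero, zero_add] at e2
    rw [hx1']
    by_contra hcon
    have h2 := mul_pos_of_neg_of_neg P.s_one_neg (not_le.mp hcon)
    have h3 := mul_nonneg (P.kap_pos 0).le (mul_nonneg P.δ_pos.le P.u_one)
    linarith

theorem Admissible.strictBelow_zero (hP : P.Admissible) {x : Plane} (hx : x ∈ P.polygon) :
    P.StrictBelow 0 (P.params.f x) := by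
  rcases hx with ⟨h0, hg⟩ | ⟨h0, hg, hK⟩
  · have hup : ∀ k ≤ P.n + 1, 0 ≤ P.g (k + 1) (P.params.f x 0) (P.params.f x 1) := by
      intro k hk
      rw [(f_left h0).1, (f_left h0).2, P.g_succ]
      exact mul_nonneg P.δ_pos.le (hg k hk)
    refine ⟨fun h1 k hk => ⟨?_, by omega⟩, fun h1 => ⟨hup _ le_rfl, ?_, by omega, by omega⟩⟩
    · rcases k with _ | k
      · exact g_zero_f_left_nonneg h0 hg h1
      · exact hup k (by omega)
    · have hb : 0 ≤ P.params.f x 1 := by rw [(f_left h0).2]; nlinarith [P.δ_pos]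
      exact (P.K_nonneg_of_upper hb (hup _ le_rfl)).1
  · obtain ⟨a1, a2, a3⟩ := hP.strictBelow_of_right h0 hg hK
    refine ⟨fun h1 k hk => ⟨(a1 h1 k hk).le, by omega⟩, fun h1 => ⟨(a2 h1).1, ?_, by omega, by omega⟩⟩
    rw [a3]; exact mul_nonneg P.δR_pos.le hg

theorem Admissible.strictBelow_succ (hP : P.Admissible) {m : ℕ} {x : Plane}
    (hx : P.StrictBelow m x) : P.StrictBelow (m + 1) (P.params.f x) := by
  have hz := hP.strictBelow_zero hx.mem_polygon
  refine ⟨fun h1 k hk => ⟨(hz.1 h1 k hk).1, fun hkm => ?_⟩,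
    fun h1 => ⟨(hz.2 h1).1, (hz.2 h1).2.1, fun hm => ?_, fun hm => ?_⟩⟩
  · rcases le_or_gt (x 0) 0 with h0 | h0
    · have hg := hx.1 h0
      rcases k with _ | k
      · refine g_zero_f_left h0 (fun k hk => (hg k hk).1) h1 ?_
        rcases h0.lt_or_eq with h | h
        · left; rw [(f_left h0).2]; nlinarith [P.δ_pos]
        · right
          have hK := (hx.2 h.ge).2.1
          rw [h, P.K_vertical] at hK
          have h2 := nonneg_of_mul_nonneg_right hK P.K_slope_pos
          have h3 := hP.Y_above
          rw [P.g_zero_vertical] at h3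
          rw [h, P.g_zero_vertical]
          nlinarith [P.s_one_neg]
      · rw [(f_left h0).1, (f_left h0).2, P.g_succ]
        exact mul_pos P.δ_pos ((hg k (by omega)).2 (by omega))
    · have h2 := hx.2 h0.le
      exact (hP.strictBelow_of_right h0.le h2.1 h2.2.1).1 h1 k hk
  · rcases le_or_gt (x 0) 0 with h0 | h0
    · rw [(f_left h0).1, (f_left h0).2, P.g_succ]
      exact mul_pos P.δ_pos ((hx.1 h0 (P.n + 1) le_rfl).2 (by omega))
    · have h2 := hx.2 h0.le
      exact ((hP.strictBelow_of_right h0.le h2.1 h2.2.1).2.1 h1).2 h0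
  · rcases le_or_gt (x 0) 0 with h0 | h0
    · have hb : 0 ≤ P.params.f x 1 := by rw [(f_left h0).2]; nlinarith [P.δ_pos]
      refine (P.K_nonneg_of_upper hb (hz.2 h1).1).2 ?_
      rw [(f_left h0).1, (f_left h0).2, P.g_succ]
      exact mul_pos P.δ_pos ((hx.1 h0 (P.n + 1) le_rfl).2 (by omega))
    · have h2 := hx.2 h0.le
      rw [(hP.strictBelow_of_right h0.le h2.1 h2.2.1).2.2]
      exact mul_pos P.δR_pos (h2.2.2.1 (by omega))

variable (P)

theorem continuous_g (k : ℕ) : Continuous fun x : Plane => P.g k (x 0) (x 1) := by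
  unfold g; fun_prop

theorem continuous_K : Continuous fun x : Plane => P.K (x 0) (x 1) := by
  unfold K; fun_prop

theorem strictBelow_mem_interior {x : Plane} (h : P.StrictBelow (P.n + 4) x) :
    x ∈ interior P.polygon := by
  have hc0 : Continuous fun x : Plane => x 0 := by fun_prop
  rw [mem_interior]
  refine ⟨(⋂ k ∈ Finset.range (P.n + 2), {x : Plane | 0 < x 0 ∨ 0 < P.g k (x 0) (x 1)}) ∩
    ({x | x 0 < 0 ∨ 0 < P.g (P.n + 2) (x 0) (x 1)} ∩ {x | x 0 < 0 ∨ 0 < P.K (x 0) (x 1)}),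
    ?_, ?_, ?_⟩
  · rintro y ⟨hy1, hy2, hy3⟩
    simp only [Set.mem_iInter, Finset.mem_range] at hy1
    rcases le_or_gt (y 0) 0 with h0 | h0
    · refine Or.inl ⟨h0, fun k hk => ?_⟩
      exact ((hy1 k (by omega)).resolve_left (not_lt.mpr h0)).le
    · exact Or.inr ⟨h0.le, (hy2.resolve_left (not_lt.mpr h0.le)).le,
        (hy3.resolve_left (not_lt.mpr h0.le)).le⟩
  · refine (isOpen_biInter_finset fun k _ => ?_).inter (IsOpen.inter ?_ ?_)
    · exact (isOpen_lt continuous_const hc0).union (isOpen_lt continuous_const (P.continuous_g k))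
    · exact (isOpen_lt hc0 continuous_const).union
        (isOpen_lt continuous_const (P.continuous_g _))
    · exact (isOpen_lt hc0 continuous_const).union (isOpen_lt continuous_const P.continuous_K)
  · refine ⟨?_, ?_, ?_⟩
    · simp only [Set.mem_iInter, Finset.mem_range]
      intro k hk
      rcases le_or_gt (x 0) 0 with h0 | h0
      · exact Or.inr ((h.1 h0 k (by omega)).2 (by omega))
      · exact Or.inl h0
    · rcases lt_or_ge (x 0) 0 with h0 | h0
      · exact Or.inl h0
      · exact Or.inr ((h.2 h0).2.2.1 (by omega))
    · rcases lt_or_ge (x 0) 0 with h0 | h0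
      · exact Or.inl h0
      · exact Or.inr ((h.2 h0).2.2.2 (by omega))

theorem norm_le_abs_add_abs (x : Plane) : ‖x‖ ≤ |x 0| + |x 1| := by
  refine le_of_sq_le_sq ?_ (by positivity)
  rw [EuclideanSpace.norm_sq_eq, Fin.sum_univ_two, Real.norm_eq_abs, Real.norm_eq_abs]
  nlinarith [abs_nonneg (x 0), abs_nonneg (x 1)]

theorem isCompact_polygon : IsCompact P.polygon := by
  have hc0 : Continuous fun x : Plane => x 0 := by fun_prop
  refine Metric.isCompact_of_isClosed_isBounded ?_ ?_
  · refine IsClosed.union ?_ ?_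
    · refine (isClosed_le hc0 continuous_const).inter ?_
      have : {x : Plane | ∀ k ≤ P.n + 1, 0 ≤ P.g k (x 0) (x 1)} =
          ⋂ k, ⋂ (_ : k ≤ P.n + 1), {x : Plane | 0 ≤ P.g k (x 0) (x 1)} := by
        ext x; simp
      change IsClosed {x : Plane | ∀ k ≤ P.n + 1, 0 ≤ P.g k (x 0) (x 1)}
      rw [this]
      exact isClosed_iInter fun k => isClosed_iInter fun _ =>
        isClosed_le continuous_const (P.continuous_g k)
    · exact (isClosed_le continuous_const hc0).inter
        ((isClosed_le continuous_const (P.continuous_g _)).inter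
          (isClosed_le continuous_const P.continuous_K))
  · obtain ⟨B, hB⟩ := P.exists_bound
    rw [isBounded_iff_forall_norm_le]
    refine ⟨max (B + B) ((P.β + 1) + (P.β - P.Y2)), ?_⟩
    rintro x (⟨h0, hg⟩ | ⟨h0, hg, hK⟩)
    · obtain ⟨h1, h2⟩ := hB _ _ h0 hg
      exact (norm_le_abs_add_abs x).trans ((add_le_add h1 h2).trans (le_max_left _ _))
    · obtain ⟨a, b, c, ha, hb, hc, hs, e0, e1⟩ := P.exists_barycentric h0 hg hK
      have hβ := P.β_pos
      have hY := P.Y2_neg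
      refine (norm_le_abs_add_abs x).trans ((add_le_add ?_ ?_).trans (le_max_right _ _))
      · rw [abs_of_nonneg h0, e0]; nlinarith
      · rw [e1, abs_le]; constructor <;> nlinarith

variable {P}

theorem Admissible.mapsTo (hP : P.Admissible) : Set.MapsTo P.params.f P.polygon P.polygon :=
  fun _ hx => (hP.strictBelow_zero hx).mem_polygon

theorem Admissible.iterate_image_subset (hP : P.Admissible) :
    P.params.f^[(P.n + 4) + 1] '' P.polygon ⊆ interior P.polygon := by
  rintro _ ⟨x, hx, rfl⟩
  apply P.strictBelow_mem_interior
  have : ∀ m, P.StrictBelow m (P.params.f^[m + 1] x) := by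
    intro m
    induction m with
    | zero => exact hP.strictBelow_zero hx
    | succ m ih => rw [Function.iterate_succ_apply']; exact hP.strictBelow_succ ih
  exact this _

theorem polygon_nonempty : P.polygon.Nonempty := by
  have hβ := P.β_pos
  refine ⟨!₂[0, P.β], Or.inr ⟨by simp, ?_, ?_⟩⟩
  · simp [g_top]; nlinarith
  · simp only [Matrix.cons_val_zero, Matrix.cons_val_one, P.K_vertical]
    exact mul_nonneg P.K_slope_pos.le (by linarith [P.Y2_neg])

theorem Admissible.exists_attractingSet (hP : P.Admissible) :
    ∃ Λ : Set Plane, IsAttractingSet P.params.f Λ ∧ Λ.Nonempty ∧ Λ ⊆ P.params.f '' P.polygon :=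
  _root_.exists_attractingSet P.params.continuous_f P.isCompact_polygon polygon_nonempty hP.mapsTo
    _ hP.iterate_image_subset

/-- Every orbit in the polygon enters the right half-plane. -/
theorem Admissible.exists_iterate_pos (hP : P.Admissible) {x : Plane} (hx : x ∈ P.polygon) :
    ∃ k, 0 < (P.params.f^[k] x) 0 := by
  by_contra! hcon
  obtain ⟨c₁, c₂, ε, hε, hd⟩ := P.exists_drift
  obtain ⟨R, hR⟩ := isBounded_iff_forall_norm_le.mp P.isCompact_polygon.isBounded
  have hmem : ∀ k, P.params.f^[k] x ∈ P.polygon := fun k => hP.mapsTo.iterate k hx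
  -- One step is discarded: a point of the polygon on the switching line may belong only to the
  -- right part, whereas an image satisfies both sets of constraints.
  have hmem' : ∀ k, 1 ≤ k → ∀ j ≤ P.n + 1,
      0 ≤ P.g j ((P.params.f^[k] x) 0) ((P.params.f^[k] x) 1) := by
    intro k hk j hj
    obtain ⟨i, rfl⟩ := Nat.exists_eq_add_of_le' hk
    rw [Function.iterate_succ_apply']
    refine ((hP.strictBelow_zero (hmem i)).1 ?_ j hj).1
    rw [← Function.iterate_succ_apply' P.params.f]
    exact hcon _
  have hgrow : ∀ k : ℕ, c₁ * (P.params.f^[1] x) 0 + c₂ * (P.params.f^[1] x) 1 + k * ε ≤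
      c₁ * (P.params.f^[k + 1] x) 0 + c₂ * (P.params.f^[k + 1] x) 1 := by
    intro k
    induction k with
    | zero => simp
    | succ k ih =>
      have h1 := hd _ _ (hcon (k + 1)) (hmem' (k + 1) (by omega) 0 (by omega))
      rw [← (f_left (hcon (k + 1))).1, ← (f_left (hcon (k + 1))).2,
        ← Function.iterate_succ_apply' P.params.f (k + 1)] at h1
      push_cast
      linarith
  have hbd : ∀ k, |c₁ * (P.params.f^[k] x) 0 + c₂ * (P.params.f^[k] x) 1| ≤
      (|c₁| + |c₂|) * R := by
    intro k
    have h0 := (PiLp.norm_apply_le (P.params.f^[k] x) 0).trans (hR _ (hmem k))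
    have h1 := (PiLp.norm_apply_le (P.params.f^[k] x) 1).trans (hR _ (hmem k))
    rw [Real.norm_eq_abs] at h0 h1
    refine (abs_add_le _ _).trans ?_
    rw [abs_mul, abs_mul, add_mul]
    gcongr
  obtain ⟨k, hk⟩ := exists_nat_gt (2 * ((|c₁| + |c₂|) * R) / ε)
  rw [div_lt_iff₀ hε] at hk
  have := hgrow k
  have := (abs_le.mp (hbd 1)).1
  have := (abs_le.mp (hbd (k + 1))).2
  linarith

/-- The number of consecutive steps in the left half-plane after a step in the right one is bounded
by the escape times of `Y` and `Z`. -/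
theorem exists_escape {p i j : ℕ} (hi : 1 ≤ i) (hip : i ≤ p) (hjp : j ≤ p)
    (hY : 0 < (P.params.fL^[i] !₂[0, P.Y2]) 0)
    (hZ : 0 < (P.params.fL^[j] !₂[P.τR * (P.β + 1) + 1, -P.δR * (P.β + 1)]) 0)
    {x : Plane} (hx0 : 0 ≤ x 0) (hK : 0 ≤ P.K (x 0) (x 1)) (hg : 0 ≤ P.g (P.n + 2) (x 0) (x 1)) (h1 : P.params.f x 0 ≤ 0) :
    ∃ k ≤ p, 0 < (P.params.fL^[k] (P.params.f x)) 0 := by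
  by_contra! hcon
  -- An orbit that fails to escape makes escape within p steps equivalent to positivity of the p-th
  -- first coordinate. That condition is affine, so it passes from Y and Z to the whole left image.
  have hall := P.params.iterate_fL_nonpos P.δ_pos (hi.trans hip) _ hcon
  have hpos : ∀ z : Plane, z 0 ≤ 0 → ∀ k ≤ p, 0 < (P.params.fL^[k] z) 0 →
      0 < (P.params.fL^[p] z) 0 := by
    intro z hz k hk hzk
    by_contra h
    exact absurd (hall z hz (not_lt.mp h) k hk) (not_le.mpr hzk)
  obtain ⟨a, b, c, hlin⟩ := P.params.exists_affine_iterate_fL p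
  have hlin' : ∀ s t, (P.params.fL^[p] !₂[s, t]) 0 = a * s + b * t + c := fun s t => by
    rw [hlin]; simp
  have key := P.affine_pos_of_right (φ := fun s t => (P.params.fL^[p] !₂[s, t]) 0) hlin'
    (hpos _ (by simp) 1 (hi.trans hip) (by simp [BCParams.fL_zero]))
    (hpos _ (by simp) i hip hY)
    (hpos _ (by
      have := P.τR_lt; have := P.β_pos
      simp only [Matrix.cons_val_zero]
      nlinarith) j hjp hZ)
    (fun h => by
      have e : P.params.fL !₂[0, P.Y2] = !₂[P.Y2 + 1, 0] := by
        ext l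
        fin_cases l
        · simp [BCParams.fL_zero]
        · simp [BCParams.fL_one]
      obtain ⟨i, rfl⟩ := Nat.exists_eq_add_of_le' hi
      rw [Function.iterate_succ_apply, e] at hY
      exact hpos _ (by simpa using h) i (by omega) hY)
    hx0 hg hK (by rw [← (f_right hx0).1]; exact h1)
  have e : P.params.f x = !₂[P.τR * x 0 + x 1 + 1, -P.δR * x 0] := by
    ext l
    fin_cases l
    · exact (f_right hx0).1
    · exact (f_right hx0).2
  have := hcon p le_rfl
  rw [e] at this
  exact absurd this (not_le.mpr key)

end PolygonData

/-! ### One-sided derivatives along orbits -/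

namespace BCParams

variable (q : BCParams)

/-- The one-sided directional derivative of the normal form at `x` in the direction `v`. -/
def tangent (x v : Plane) : Plane :=
  if x 0 < 0 ∨ (x 0 = 0 ∧ v 0 ≤ 0) then Matrix.toEuclideanLin (bcMatrix q.τL q.δL) v
  else Matrix.toEuclideanLin (bcMatrix q.τR q.δR) v

/-- The action of the normal form on points with tangent vectors. -/
def skew (z : Plane × Plane) : Plane × Plane := (q.f z.1, q.tangent z.1 z.2)

theorem halfMap_add_smul (τ δ : ℝ) (x v : Plane) (t : ℝ) : halfMap τ δ (x + t • v) =
    halfMap τ δ x + t • Matrix.toEuclideanLin (bcMatrix τ δ) v := by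
  simp only [halfMap, map_add, map_smul]
  abel

theorem eventually_f_add_smul (x v : Plane) :
    ∀ᶠ t : ℝ in 𝓝[>] 0, q.f (x + t • v) = q.f x + t • q.tangent x v := by
  have hc : Tendsto (fun t : ℝ => (x + t • v) 0) (𝓝[>] 0) (𝓝 (x 0)) := by
    have : Continuous fun t : ℝ => (x + t • v) 0 := by fun_prop
    have h := (this.tendsto 0).mono_left (nhdsWithin_le_nhds (s := Set.Ioi 0))
    simpa using h
  have hval : ∀ t : ℝ, (x + t • v) 0 = x 0 + t * v 0 := fun t => by simp
  unfold tangent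
  split_ifs with h
  · have hx : x 0 ≤ 0 := h.elim le_of_lt fun h => h.1.le
    have hev : ∀ᶠ t : ℝ in 𝓝[>] 0, (x + t • v) 0 ≤ 0 := by
      rcases h with h | ⟨h, hv⟩
      · exact (hc.eventually_lt_const h).mono fun _ h => le_of_lt h
      · filter_upwards [self_mem_nhdsWithin] with t ht
        rw [hval, h, zero_add]
        exact mul_nonpos_of_nonneg_of_nonpos (le_of_lt ht) hv
    filter_upwards [hev] with t ht
    rw [f_of_nonpos _ ht, f_of_nonpos _ hx, fL, halfMap_add_smul]
  · push Not at h
    have hev : ∀ᶠ t : ℝ in 𝓝[>] 0, 0 ≤ (x + t • v) 0 := by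
      rcases h.1.lt_or_eq with h0 | h0
      · exact (hc.eventually_const_lt h0).mono fun _ h => le_of_lt h
      · filter_upwards [self_mem_nhdsWithin] with t ht
        rw [hval, ← h0, zero_add]
        exact mul_nonneg (le_of_lt ht) (h.2 h0.symm).le
    filter_upwards [hev] with t ht
    rw [f_of_nonneg _ _ ht, f_of_nonneg _ _ h.1, fR, halfMap_add_smul]

theorem skew_iterate_fst (n : ℕ) (z : Plane × Plane) : (q.skew^[n] z).1 = q.f^[n] z.1 := by
  induction n with
  | zero => rfl
  | succ n ih => rw [Function.iterate_succ_apply', Function.iterate_succ_apply', ← ih]; rfl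

theorem hasOneSidedDeriv_iterate (n : ℕ) (x v : Plane) :
    HasOneSidedDeriv (q.f^[n]) x v (q.skew^[n] (x, v)).2 := by
  have key : ∀ᶠ t : ℝ in 𝓝[>] 0,
      q.f^[n] (x + t • v) = q.f^[n] x + t • (q.skew^[n] (x, v)).2 := by
    induction n with
    | zero => simp
    | succ n ih =>
      filter_upwards [ih, q.eventually_f_add_smul (q.f^[n] x) (q.skew^[n] (x, v)).2] with t h1 h2
      rw [Function.iterate_succ_apply', h1, h2, Function.iterate_succ_apply',
        Function.iterate_succ_apply', skew, q.skew_iterate_fst]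
  refine tendsto_const_nhds.congr' ?_
  filter_upwards [key, self_mem_nhdsWithin] with t ht ht0
  rw [ht, add_sub_cancel_left, smul_smul, inv_mul_cancel₀ (ne_of_gt ht0), one_smul]

theorem exists_toEuclideanLin_eq {τ δ : ℝ} (hδ : 0 < δ) (w : Plane) :
    ∃ v : Plane, v 0 = -(w 1 / δ) ∧ Matrix.toEuclideanLin (bcMatrix τ δ) v = w := by
  refine ⟨!₂[-(w 1 / δ), w 0 + τ * (w 1 / δ)], by simp, ?_⟩
  ext i
  fin_cases i
  · simp [bcMatrix]; ring
  · simp [bcMatrix]; field_simp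

theorem exists_tangent_eq (hL : 0 < q.δL) (hR : 0 < q.δR) (x w : Plane) :
    ∃ v, q.tangent x v = w := by
  obtain ⟨v, hv, e⟩ := exists_toEuclideanLin_eq (τ := q.τL) hL w
  obtain ⟨v', hv', e'⟩ := exists_toEuclideanLin_eq (τ := q.τR) hR w
  rcases lt_trichotomy (x 0) 0 with h | h | h
  · exact ⟨v, by rw [tangent, if_pos (Or.inl h), e]⟩
  · rcases le_or_gt 0 (w 1) with hw | hw
    · have hv0 : v 0 ≤ 0 := by rw [hv]; linarith [div_nonneg hw hL.le]
      exact ⟨v, by rw [tangent, if_pos (Or.inr ⟨h, hv0⟩), e]⟩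
    · refine ⟨v', ?_⟩
      rw [tangent, if_neg, e']
      rintro (h' | ⟨-, h'⟩)
      · exact h'.ne h
      · rw [hv'] at h'
        have := div_neg_of_neg_of_pos hw hR
        linarith
  · refine ⟨v', ?_⟩
    rw [tangent, if_neg, e']
    rintro (h' | ⟨h', -⟩) <;> linarith

/-- Each one-step derivative is onto, even on the switching line, where the sign of the second
coordinate of the target selects the branch. So a vector wanted at a later time can be pulled back.
-/
theorem exists_skew_iterate_eq (hL : 0 < q.δL) (hR : 0 < q.δR) (n : ℕ) : ∀ x w : Plane,
    ∃ v, (q.skew^[n] (x, v)).2 = w := by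
  induction n with
  | zero => exact fun x w => ⟨w, rfl⟩
  | succ n ih =>
    intro x w
    obtain ⟨v', hv'⟩ := ih (q.f x) w
    obtain ⟨v, hv⟩ := q.exists_tangent_eq hL hR x v'
    refine ⟨v, ?_⟩
    rw [Function.iterate_succ_apply, skew, hv]
    exact hv'

theorem exists_norm_skew_iterate_le : ∃ C : ℝ, 1 ≤ C ∧ ∀ n (z : Plane × Plane),
    ‖(q.skew^[n] z).2‖ ≤ C ^ n * ‖z.2‖ := by
  set TL := LinearMap.toContinuousLinearMap (Matrix.toEuclideanLin (bcMatrix q.τL q.δL))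
  set TR := LinearMap.toContinuousLinearMap (Matrix.toEuclideanLin (bcMatrix q.τR q.δR))
  have h1 : 1 ≤ 1 + ‖TL‖ + ‖TR‖ := by
    have := norm_nonneg TL; have := norm_nonneg TR; linarith
  refine ⟨1 + ‖TL‖ + ‖TR‖, h1, fun n z => ?_⟩
  have step : ∀ x v : Plane, ‖q.tangent x v‖ ≤ (1 + ‖TL‖ + ‖TR‖) * ‖v‖ := by
    intro x v
    unfold tangent
    split_ifs
    · refine (TL.le_opNorm v).trans ?_
      gcongr
      have := norm_nonneg TR; linarith
    · refine (TR.le_opNorm v).trans ?_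
      gcongr
      have := norm_nonneg TL; linarith
  induction n with
  | zero => simp
  | succ n ih =>
    rw [Function.iterate_succ_apply', pow_succ', mul_assoc]
    exact (step _ _).trans (mul_le_mul_of_nonneg_left ih (by linarith))

/-- The next step of the orbit, with its tangent vector, is governed by the right half-map. -/
def IsRight (z : Plane × Plane) : Prop := 0 < z.1 0 ∨ (z.1 0 = 0 ∧ 0 < z.2 0)

theorem skew_of_isRight {z : Plane × Plane} (h : IsRight z) :
    q.skew z = (q.f z.1, Matrix.toEuclideanLin (bcMatrix q.τR q.δR) z.2) := by
  rw [skew, tangent, if_neg]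
  rintro (h' | ⟨h', h''⟩) <;> rcases h with h | ⟨h, h2⟩ <;> linarith

theorem skew_of_not_isRight {z : Plane × Plane} (h : ¬ IsRight z) :
    z.1 0 ≤ 0 ∧ q.skew z = (q.fL z.1, Matrix.toEuclideanLin (bcMatrix q.τL q.δL) z.2) := by
  unfold IsRight at h
  push Not at h
  refine ⟨h.1, ?_⟩
  rw [skew, tangent, if_pos, f_of_nonpos _ h.1]
  rcases h.1.lt_or_eq with h0 | h0
  · exact Or.inl h0
  · exact Or.inr ⟨h0, h.2 h0⟩

theorem toEuclideanLin_mul (M N : Matrix (Fin 2) (Fin 2) ℝ) (v : Plane) :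
    Matrix.toEuclideanLin (M * N) v = Matrix.toEuclideanLin M (Matrix.toEuclideanLin N v) := by
  ext i
  fin_cases i
  · simp only [Fin.zero_eta, toEuclideanLin_zero, toEuclideanLin_one, Matrix.mul_apply,
      Fin.sum_univ_two]
    ring
  · simp only [Fin.mk_one, toEuclideanLin_zero, toEuclideanLin_one, Matrix.mul_apply,
      Fin.sum_univ_two]
    ring

theorem skew_iterate_of_not_isRight {z : Plane × Plane} (n : ℕ)
    (h : ∀ i < n, ¬ IsRight (q.skew^[i] z)) :
    q.skew^[n] z = (q.fL^[n] z.1, Matrix.toEuclideanLin (bcMatrix q.τL q.δL ^ n) z.2) := by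
  induction n with
  | zero => simp
  | succ n ih =>
    rw [Function.iterate_succ_apply', (q.skew_of_not_isRight (h n (by omega))).2,
      ih fun i hi => h i (by omega), Function.iterate_succ_apply', pow_succ', toEuclideanLin_mul]

end BCParams

/-! ### Growth along words and the Lyapunov exponent -/

namespace PolygonData

variable {P : PolygonData}

/-- The points `Y` and `Z` leave the left half-plane within `p` steps of the left half-map. -/
def EscapesWithin (P : PolygonData) (p : ℕ) : Prop :=
  ∃ i j, 1 ≤ i ∧ i ≤ p ∧ j ≤ p ∧ 0 < (P.params.fL^[i] !₂[0, P.Y2]) 0 ∧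
    0 < (P.params.fL^[j] !₂[P.τR * (P.β + 1) + 1, -P.δR * (P.β + 1)]) 0

/-- Each word `R L^i` that occurs along an orbit in the polygon preserves and expands the cone. -/
theorem Admissible.exists_block (hP : P.Admissible) {p : ℕ} (he : P.EscapesWithin p)
    (h3 : P.params.C3 p) (h4 : P.params.C4 p) {c : ℝ}
    (hc : ∀ j ∈ Finset.Icc 1 (p + 1), ∀ v ∈ P.params.cone p,
      c * ‖v‖ ≤ ‖Matrix.toEuclideanLin (P.params.wordMatrix j) v‖)
    {z : Plane × Plane} (h1 : z.1 ∈ P.params.f '' P.polygon) (h2 : BCParams.IsRight z)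
    (hz : z.2 ∈ P.params.cone p) :
    ∃ j, 1 ≤ j ∧ j ≤ p + 1 ∧ (P.params.skew^[j] z).1 ∈ P.params.f '' P.polygon ∧
      BCParams.IsRight (P.params.skew^[j] z) ∧ (P.params.skew^[j] z).2 ∈ P.params.cone p ∧
      c * ‖z.2‖ ≤ ‖(P.params.skew^[j] z).2‖ := by
  classical
  obtain ⟨x, hx, hxz⟩ := h1
  have hs := hP.strictBelow_zero hx
  rw [hxz] at hs
  have hz0 : 0 ≤ z.1 0 := h2.elim le_of_lt fun h => h.1.ge
  set y : Plane × Plane := P.params.skew z with hy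
  have hyv := P.params.skew_of_isRight h2
  have hex : ∃ i ≤ p, BCParams.IsRight (P.params.skew^[i] y) := by
    by_contra! hcon
    have hy0 : P.params.f z.1 0 ≤ 0 := by
      have := (P.params.skew_of_not_isRight (hcon 0 (Nat.zero_le _))).1
      rwa [Function.iterate_zero, id, hy, hyv] at this
    obtain ⟨i, j, hi1, hi2, hj, hY, hZ⟩ := he
    obtain ⟨k, hk, hpos⟩ := P.exists_escape hi1 hi2 hj hY hZ hz0 (hs.2 hz0).2.1 (hs.2 hz0).1 hy0
    refine hcon k hk (Or.inl ?_)
    rw [P.params.skew_iterate_of_not_isRight k fun i hi => hcon i (by omega), hy, hyv]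
    exact hpos
  have hex' : ∃ i, BCParams.IsRight (P.params.skew^[i] y) := hex.imp fun _ h => h.2
  obtain ⟨i, hi, hir, hmin⟩ : ∃ i ≤ p, BCParams.IsRight (P.params.skew^[i] y) ∧
      ∀ k < i, ¬ BCParams.IsRight (P.params.skew^[k] y) := by
    obtain ⟨k, hk, hkr⟩ := hex
    exact ⟨Nat.find hex', (Nat.find_min' hex' hkr).trans hk, Nat.find_spec hex',
      fun k hk => Nat.find_min hex' hk⟩
  have hj : i + 1 ∈ Finset.Icc 1 (p + 1) := by simp; omega
  have hv : (P.params.skew^[i + 1] z).2 =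
      Matrix.toEuclideanLin (P.params.wordMatrix (i + 1)) z.2 := by
    rw [Function.iterate_succ_apply, ← hy, P.params.skew_iterate_of_not_isRight i hmin, hy, hyv,
      BCParams.wordMatrix, Nat.add_sub_cancel, BCParams.toEuclideanLin_mul]
  refine ⟨i + 1, by omega, by omega, ?_, by rwa [Function.iterate_succ_apply, ← hy], ?_, ?_⟩
  · rw [P.params.skew_iterate_fst, Function.iterate_succ_apply']
    refine ⟨_, hP.mapsTo.iterate i ?_, rfl⟩
    rw [← hxz]
    exact hP.mapsTo hx
  · rw [hv]; exact P.params.wordMatrix_mem_cone h3 h4 hj hz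
  · rw [hv]; exact hc _ hj _ hz

theorem Admissible.exists_lyapunovExponent (hP : P.Admissible) {p : ℕ} (he : P.EscapesWithin p)
    (h3 : P.params.C3 p) (h4 : P.params.C4 p) (h5 : P.params.C5 p) {x : Plane}
    (hx : x ∈ P.params.f '' P.polygon) :
    ∃ v : Plane, ∃ lam : ℝ, 0 < lam ∧ IsLyapunovExponent P.params.f x v (lam : EReal) := by
  have hxP : x ∈ P.polygon := by
    obtain ⟨y, hy, rfl⟩ := hx
    exact hP.mapsTo hy
  obtain ⟨k, hk⟩ := hP.exists_iterate_pos hxP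
  obtain ⟨c, hc1, hc⟩ := P.params.exists_expansion h5
  have h1mem : 1 ∈ Finset.Icc 1 (p + 1) := by simp
  obtain ⟨m, -, -, -, hm, -⟩ := exists_slopes (h3 1 h1mem).1 (h3 1 h1mem).2.1 (h3 1 h1mem).2.2
  have hmJ := P.params.mem_Icc_of_mem_stableSlopes h3 ⟨1, h1mem, hm⟩
  -- The direction v is the one that becomes (1, m), with m a stable slope, when the orbit is first
  -- known to be on the right.
  obtain ⟨v, hv⟩ := P.params.exists_skew_iterate_eq P.δ_pos P.δR_pos k x !₂[1, m]
  set z := P.params.skew^[k] (x, v) with hzdef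
  have hz1 : z.1 = P.params.f^[k] x := P.params.skew_iterate_fst k _
  have hz2 : z.2 ∈ P.params.cone p := by
    rw [hv]
    exact ⟨by simp, by simpa using hmJ⟩
  have hzim : z.1 ∈ P.params.f '' P.polygon := by
    rw [hz1]
    obtain ⟨y, hy, rfl⟩ := hx
    rw [← Function.iterate_succ_apply, Function.iterate_succ_apply']
    exact ⟨_, hP.mapsTo.iterate k hy, rfl⟩
  have hblocks : ∀ i : ℕ, ∃ n, i ≤ n ∧ n ≤ i * (p + 1) ∧
      (P.params.skew^[n] z).1 ∈ P.params.f '' P.polygon ∧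
      BCParams.IsRight (P.params.skew^[n] z) ∧ (P.params.skew^[n] z).2 ∈ P.params.cone p ∧
      c ^ i * ‖z.2‖ ≤ ‖(P.params.skew^[n] z).2‖ := by
    intro i
    induction i with
    | zero =>
      exact ⟨0, le_rfl, by omega, hzim, Or.inl (by rw [Function.iterate_zero, id, hz1]; exact hk),
        hz2, by simp⟩
    | succ i ih =>
      obtain ⟨n, hn1, hn2, a1, a2, a3, a4⟩ := ih
      obtain ⟨j, hj1, hj2, b1, b2, b3, b4⟩ := hP.exists_block he h3 h4 hc a1 a2 a3
      rw [← Function.iterate_add_apply P.params.skew j n z] at b1 b2 b3 b4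
      refine ⟨j + n, by omega, by rw [Nat.succ_mul]; omega, b1, b2, b3, le_trans ?_ b4⟩
      rw [pow_succ', mul_assoc]
      exact mul_le_mul_of_nonneg_left a4 (by linarith)
  obtain ⟨C, hC1, hC⟩ := P.params.exists_norm_skew_iterate_le
  have hzpos : 0 < ‖z.2‖ := by
    rw [norm_pos_iff]
    intro h
    have := hz2.1
    rw [h] at this
    simp at this
  have hlow : ∀ i : ℕ, ∃ n, i ≤ n ∧ n ≤ k + i * (p + 1) ∧
      ‖z.2‖ * c ^ i ≤ ‖(P.params.skew^[n] (x, v)).2‖ := by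
    intro i
    obtain ⟨n, hn1, hn2, -, -, -, h⟩ := hblocks i
    refine ⟨n + k, by omega, by omega, ?_⟩
    rw [Function.iterate_add_apply, mul_comm]
    exact h
  have hup : ∀ n, ‖(P.params.skew^[n] (x, v)).2‖ ≤ C ^ n * max 1 ‖v‖ := fun n =>
    (hC n (x, v)).trans (mul_le_mul_of_nonneg_left (le_max_right _ _) (by positivity))
  obtain ⟨lam, hlam, e⟩ :=
    exists_pos_limsup_log_of_blocks hc1 hzpos hC1 (le_max_left _ _) hlow hup
  exact ⟨v, lam, hlam, fun n => (P.params.skew^[n] (x, v)).2,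
    fun n _ => P.params.hasOneSidedDeriv_iterate n x v, e⟩

end PolygonData

/-! ### From the tests of the algorithm to an admissible polygon -/

namespace BCParams

variable (q : BCParams)

theorem tests_of_loopEnds {βstep βmax : ℝ} (hstep : 0 < βstep) {s t : SearchState}
    (h : q.LoopEnds βstep βmax s t) (hs : 0 < s.beta)
    (hs' : s.chaos = true → q.C1 s.beta ∧ q.C2 s.beta) :
    0 < t.beta ∧ (t.chaos = true → q.C1 t.beta ∧ q.C2 t.beta) := by
  induction h with
  | exit s _ => exact ⟨hs, hs'⟩
  | pass s t hg _ ih =>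
    apply ih
    · unfold loopBody
      split_ifs
      · exact hs
      · exact add_pos hs hstep
      · exact add_pos hs hstep
    · unfold loopBody
      split_ifs with h1 h2
      · exact fun _ => ⟨h1, h2⟩
      · intro h; simp only at h; rw [hg.1] at h; simp at h
      · intro h; simp only at h; rw [hg.1] at h; simp at h

theorem of_coneCheck {p : ℕ} (h : q.coneCheck p = true) : q.C3 p ∧ q.C4 p ∧ q.C5 p := by
  unfold coneCheck at h
  split_ifs at h with h3 h4 h5
  exact ⟨h3, h4, h5⟩

theorem wordMatrix_one : q.wordMatrix 1 = bcMatrix q.τR q.δR := by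
  simp [wordMatrix]

theorem ptX_zero (β : ℝ) : ptX β 0 = 0 := by simp [ptX]

theorem ptX_one (β : ℝ) : ptX β 1 = β := by simp [ptX]

theorem f_right {x : Plane} (hx : 0 ≤ x 0) :
    q.f x 0 = q.τR * x 0 + x 1 + 1 ∧ q.f x 1 = -q.δR * x 0 := by
  rw [f_of_nonneg _ _ hx]
  exact ⟨q.fR_zero x, q.fR_one x⟩

/-- If `A_R` has positive eigenvalues, the largest of which exceeds one, then the orbit of `X` never
leaves the right half-plane. -/
theorem rSet_eq_empty {β ls lu : ℝ} (hβ : 0 < β) (hs : 1 < ls) (hu : 0 < lu)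
    (hsum : ls + lu = q.τR) (hprod : ls * lu = q.δR) : q.rSet β = ∅ := by
  -- The last two clauses say that the increment of the first coordinate is positive and that the
  -- next increment exceeds lu times it; the latter excess is multiplied by ls at each step.
  have key : ∀ i, 0 ≤ (q.f^[i] (ptX β)) 0 ∧
      0 < (q.τR - 1) * (q.f^[i] (ptX β)) 0 + (q.f^[i] (ptX β)) 1 + 1 ∧
      lu * ((q.τR - 1) * (q.f^[i] (ptX β)) 0 + (q.f^[i] (ptX β)) 1 + 1) <
        (q.τR - 1) * (q.τR * (q.f^[i] (ptX β)) 0 + (q.f^[i] (ptX β)) 1 + 1) -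
          q.δR * (q.f^[i] (ptX β)) 0 + 1 := by
    intro i
    induction i with
    | zero =>
      simp only [Function.iterate_zero, id, ptX_zero, ptX_one]
      refine ⟨le_rfl, by linarith, ?_⟩
      rw [← hsum]
      nlinarith
    | succ i ih =>
      rw [Function.iterate_succ_apply']
      set x := q.f^[i] (ptX β)
      obtain ⟨h0, h1, h2⟩ := ih
      rw [(q.f_right h0).1, (q.f_right h0).2]
      refine ⟨by linarith, ?_, ?_⟩
      · have := mul_pos hu h1
        linarith
      · have := mul_lt_mul_of_pos_left h2 (by linarith : 0 < ls)
        rw [← hsum, ← hprod] at *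
        linarith
  ext i
  simp only [rSet, Set.mem_ofPred_eq, Set.mem_empty_iff_false, iff_false, not_and, not_le]
  intro hi
  obtain ⟨j, rfl⟩ := Nat.exists_eq_add_of_le' hi
  obtain ⟨h0, h1, -⟩ := key j
  rw [Function.iterate_succ_apply', (q.f_right h0).1]
  linarith

/-- Positivity of the quadratic at the stable slope of A_R gives a dominant eigenvalue of modulus
above 1. Both eigenvalues share its sign; positive ones would contradict the existence of r by
`rSet_eq_empty`, and negative ones sum to less than -1. -/
theorem τR_lt_neg_one {β : ℝ} (hβ : 0 < β) (hr : (q.rSet β).Nonempty) {p : ℕ} (h3 : q.C3 p)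
    (h5 : q.C5 p) : q.τR < -1 := by
  have h1mem : 1 ∈ Finset.Icc 1 (p + 1) := by simp
  have h3' := h3 1 h1mem
  obtain ⟨ms, mu, ls, lu, hm, -, -, e1, e2, -, -, h0, h1, hsum, hprod, -⟩ :=
    exists_slopes h3'.1 h3'.2.1 h3'.2.2
  have hH := q.quadH_pos h5 h1mem (q.mem_Icc_of_mem_stableSlopes h3 ⟨1, h1mem, hm⟩)
  rw [quadH_eq_of_eigen e1 e2] at hH
  have hls : 0 < ls ^ 2 - 1 := pos_of_mul_pos_left hH (by positivity)
  rw [wordMatrix_one] at hsum hprod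
  simp only [bcMatrix, Matrix.trace_fin_two, Matrix.det_fin_two, Matrix.of_apply, Matrix.cons_val',
    Matrix.cons_val_zero, Matrix.cons_val_one, Matrix.cons_val_fin_one] at hsum hprod
  rcases le_or_gt ls 0 with h | h
  · have hlu : lu < 0 := by
      by_contra hcon
      exact absurd h0 (not_lt.mpr (div_nonpos_of_nonneg_of_nonpos (not_lt.mp hcon) h))
    nlinarith
  · have hlu : 0 < lu := by
      have := mul_pos h0 h
      rwa [div_mul_cancel₀ _ h.ne'] at this
    have := q.rSet_eq_empty (ls := ls) (lu := lu) hβ (by nlinarith) hlu (by linarith) (by linarith)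
    rw [this] at hr
    exact absurd hr Set.not_nonempty_empty

theorem f_ptX {β : ℝ} : q.f (ptX β) = !₂[β + 1, 0] := by
  have h := q.f_right (x := ptX β) (ptX_zero β).ge
  rw [ptX_zero, ptX_one] at h
  ext i
  fin_cases i
  · simpa using h.1
  · simpa using h.2

theorem ptZ_eq {β : ℝ} (hβ : 0 < β) (hτ : q.τR < -1) :
    q.ptZ β = !₂[q.τR * (β + 1) + 1, -q.δR * (β + 1)] ∧
      q.fInv (q.ptZ β) = q.fInv (q.f (q.f (ptX β))) := by
  have h2 : q.f (q.f (ptX β)) = !₂[q.τR * (β + 1) + 1, -q.δR * (β + 1)] := by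
    have h := q.f_right (x := q.f (ptX β)) (by rw [f_ptX]; simp; linarith)
    rw [f_ptX] at h ⊢
    ext i
    fin_cases i
    · simpa using h.1
    · simpa using h.2
  have hr : q.r β = 2 := by
    have hmem : 2 ∈ q.rSet β := by
      refine ⟨by norm_num, ?_⟩
      change (q.f (q.f (ptX β))) 0 ≤ 0
      rw [h2]
      simp only [Matrix.cons_val_zero]
      nlinarith
    refine le_antisymm (Nat.sInf_le hmem) ?_
    obtain ⟨h1, h1'⟩ := Nat.sInf_mem ⟨2, hmem⟩
    change 1 ≤ q.r β at h1
    change (q.f^[q.r β] (ptX β)) 0 ≤ 0 at h1'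
    by_contra hcon
    have : q.r β = 1 := by omega
    rw [this, Function.iterate_one, f_ptX] at h1'
    simp at h1'
    linarith
  have h3 : q.ptZ β = q.f (q.f (ptX β)) := by rw [ptZ, hr]; rfl
  rw [h3]
  exact ⟨h2, rfl⟩

/-- The backward orbit of `X` up to the point `V`, as a forward orbit of the left half-map. -/
theorem exists_chain (hL : 0 < q.δL) (hR : 0 < q.δR) {β : ℝ} (hβ : 0 < β)
    (hne : (q.ellSet β).Nonempty) :
    ∃ (n : ℕ) (u : ℕ → ℝ), (∀ k, u (k + 2) = q.τL * u (k + 1) - q.δL * u k + 1) ∧ 0 ≤ u 1 ∧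
      (∀ k, k ≤ n → u (k + 2) < 0) ∧ u (n + 3) = 0 ∧ β = -q.δL * u (n + 2) ∧
      (q.τL ≤ 0 → n = 0) ∧ q.ptV β 0 = u 2 ∧ q.ptV β 1 = -q.δL * u 1 := by
  have hneg : ∀ {y : Plane}, 0 < y 1 → q.fInv y 0 < 0 := by
    intro y hy
    rw [fInv, if_pos hy.le]
    simpa using div_pos hy hL
  have hnonpos : ∀ {y : Plane}, 0 ≤ q.fInv y 0 → y 1 ≤ 0 := fun h => by
    by_contra hcon
    exact absurd h (not_le.mpr (hneg (not_le.mp hcon)))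
  obtain ⟨hm1, hm2⟩ := Nat.sInf_mem hne
  change 1 ≤ q.ell β at hm1
  change 0 ≤ (q.fInv^[q.ell β] (ptX β)) 0 at hm2
  have hmin : ∀ j, 1 ≤ j → j < q.ell β → (q.fInv^[j] (ptX β)) 0 < 0 := by
    intro j hj1 hj2
    by_contra hcon
    exact Nat.notMem_of_lt_sInf hj2 ⟨hj1, not_lt.mp hcon⟩
  have hm : 2 ≤ q.ell β := by
    by_contra hcon
    have h1 : q.ell β = 1 := by omega
    rw [h1, Function.iterate_one] at hm2
    have := hnonpos hm2
    rw [ptX_one] at this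
    linarith
  obtain ⟨n, hn⟩ := Nat.exists_eq_add_of_le' hm
  have hVdef : q.ptV β = q.fInv^[n + 1] (ptX β) := by rw [ptV, hn]; rfl
  set V := q.ptV β with hV
  have hV1 : V 1 ≤ 0 := by
    apply hnonpos
    rw [hVdef, ← Function.iterate_succ_apply' q.fInv]
    rwa [hn] at hm2
  obtain ⟨u₁, hu₁⟩ : ∃ u₁, -q.δL * u₁ = V 1 := ⟨-(V 1 / q.δL), by field_simp⟩
  obtain ⟨u₀, hu₀⟩ : ∃ u₀, q.τL * u₁ - q.δL * u₀ + 1 = V 0 :=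
    ⟨(q.τL * u₁ - V 0 + 1) / q.δL, by field_simp; ring⟩
  set W : Plane := !₂[u₀, u₁ - q.τL * u₀ - 1] with hW
  have hW2 : q.fL^[2] W = V := by
    change q.fL (q.fL W) = V
    ext i
    fin_cases i
    · simp [fL_zero, fL_one, hW, ← hu₀]; ring
    · simp [fL_zero, fL_one, hW, ← hu₁]
      left
      ring
  have hu1 : (q.fL^[1] W) 0 = u₁ := by simp [fL_zero, hW]; ring
  have hback : ∀ k ≤ n + 1, q.fL^[k + 2] W = q.fInv^[n + 1 - k] (ptX β) := by
    intro k
    induction k with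
    | zero => intro _; rw [zero_add, hW2, hVdef]; rfl
    | succ k ih =>
      intro hk
      obtain ⟨j, hj⟩ : ∃ j, n + 1 - k = j + 1 := ⟨n - k, by omega⟩
      rw [show k + 1 + 2 = (k + 2) + 1 by ring, Function.iterate_succ_apply', ih (by omega),
        show n + 1 - (k + 1) = j by omega, hj]
      have hlt := hmin (j + 1) (by omega) (by omega)
      rw [← q.f_of_nonpos hlt.le, Function.iterate_succ_apply', q.f_fInv hL hR]
  have hlast : q.fL^[n + 3] W = ptX β := by
    have := hback (n + 1) le_rfl
    simpa using this
  refine ⟨n, fun k => (q.fL^[k] W) 0, fun k => ?_, ?_, fun k hk => ?_, ?_, ?_, fun hτ => ?_, ?_, ?_⟩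
  · change (q.fL^[k + 1 + 1] W) 0 = _
    have e : (q.fL^[k + 1] W) 1 = -q.δL * (q.fL^[k] W) 0 := by
      rw [Function.iterate_succ_apply', fL_one]
    rw [Function.iterate_succ_apply', fL_zero, e]
    ring
  · change 0 ≤ (q.fL^[1] W) 0
    rw [hu1]
    by_contra hcon
    have := mul_pos hL (neg_pos.mpr (not_le.mp hcon))
    linarith
  · change (q.fL^[k + 2] W) 0 < 0
    rw [hback k (by omega)]
    exact hmin _ (by omega) (by omega)
  · change (q.fL^[n + 3] W) 0 = 0
    rw [hlast, ptX_zero]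
  · change β = -q.δL * (q.fL^[n + 2] W) 0
    rw [← fL_one, ← Function.iterate_succ_apply' q.fL, hlast, ptX_one]
  -- For τ_L ≤ 0 the first preimage of X lies below the axis, so the second lies on the right and ℓ
  -- = 2.
  · have h1 : q.fInv (ptX β) 1 < 0 := by
      have : q.fInv (ptX β) = !₂[-(β / q.δL), 0 - 1 + q.τL * (β / q.δL)] := by
        rw [fInv, if_pos (by rw [ptX_one]; exact hβ.le), ptX_one, ptX_zero]
      rw [this]
      have := mul_nonpos_of_nonpos_of_nonneg hτ (div_pos hβ hL).le
      simp only [Matrix.cons_val_one, Matrix.cons_val_zero]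
      linarith
    have h2 : 2 ∈ q.ellSet β := by
      refine ⟨by norm_num, ?_⟩
      change 0 ≤ q.fInv (q.fInv (ptX β)) 0
      rw [fInv, if_neg (not_le.mpr h1)]
      have := div_neg_of_neg_of_pos h1 hR
      simp only [Matrix.cons_val_zero]
      linarith
    have : q.ell β ≤ 2 := Nat.sInf_le h2
    omega
  · change V 0 = (q.fL^[2] W) 0
    rw [hW2]
  · change V 1 = -q.δL * (q.fL^[1] W) 0
    rw [hu1, hu₁]

end BCParams

theorem PolygonData.g_of_mem_line (P : PolygonData) (k : ℕ) {A B C : Plane}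
    (hA : P.g k (A 0) (A 1) = 0) (hB : P.g k (B 0) (B 1) = 0) (hC : C ∈ line[ℝ, A, B]) :
    P.g k (C 0) (C 1) = 0 := by
  obtain ⟨t, rfl⟩ := mem_affineSpan_pair_iff_exists_lineMap_eq.mp hC
  have h0 : ∀ i, (AffineMap.lineMap A B t : Plane) i = A i + t * (B i - A i) := by
    intro i; simp [AffineMap.lineMap_apply]; ring
  rw [h0, h0]
  simp only [PolygonData.g] at *
  linear_combination (1 - t) * hA + t * hB

/-- The tests of the search yield an admissible polygon. -/
theorem BCParams.exists_polygonData (q : BCParams) (hL : 0 < q.δL) (hR : 0 < q.δR) {β : ℝ}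
    (hβ : 0 < β) (h1 : q.C1 β) (h2 : q.C2 β) {p : ℕ} (hp : q.pMax β = p) (h3 : q.C3 p)
    (h5 : q.C5 p) : ∃ P : PolygonData, P.params = q ∧ P.Admissible ∧ P.EscapesWithin p := by
  have hτ := q.τR_lt_neg_one hβ h1.1 h3 h5
  obtain ⟨n, u, hrec, hu1, hneg, hend, hβu, hn, hV0, hV1⟩ := q.exists_chain hL hR hβ h1.2
  obtain ⟨hZ, hZ'⟩ := q.ptZ_eq hβ hτ
  rw [q.fInv_f hL hR, q.f_ptX] at hZ'
  set P : PolygonData := ⟨q.τL, q.δL, q.τR, q.δR, β, n, u, hL, hR, hβ, hτ, hrec, hu1, hneg, hend,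
    hβu, hn⟩ with hP
  have hZ0 : q.ptZ β 0 = P.τR * (P.β + 1) + 1 := by rw [hZ]; simp [hP]
  have hZ1 : q.ptZ β 1 = -P.δR * (P.β + 1) := by rw [hZ]; simp [hP]
  have hY : q.ptY β = !₂[0, P.Y2] := by
    have hE := P.K_slope_pos
    have hmul := P.Y2_mul
    rw [ptY, hZ']
    symm
    have hne : q.ptZ β 0 ≠ (!₂[β + 1, 0] : Plane) 0 := by
      rw [hZ0]
      have : P.τR * (P.β + 1) + 1 < 0 := by nlinarith [P.τR_lt, P.β_pos]
      simp only [Matrix.cons_val_zero]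
      linarith
    rw [eq_meet_iff 0 _ _ _ hne]
    refine ⟨mem_affineSpan_pair_iff_exists_lineMap_eq.mpr
      ⟨-(P.τR * (P.β + 1) + 1) / (P.β - P.τR * (P.β + 1)), ?_⟩, by simp⟩
    have hβP : P.β = β := rfl
    ext i
    fin_cases i
    · simp [AffineMap.lineMap_apply, hZ0]
      rw [← hβP]
      field_simp
      ring
    · simp [AffineMap.lineMap_apply, hZ1]
      field_simp
      linear_combination -hmul
  have hs1 := P.s_one_neg
  have hVu : P.u 2 < 0 := P.u_neg 0 (Nat.zero_le _)
  have hV0' : q.ptV β 0 = P.u 2 := hV0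
  have hV1' : q.ptV β 1 = -P.δ * P.u 1 := hV1
  have hfV : q.f (q.ptV β) 0 = P.u 3 ∧ q.f (q.ptV β) 1 = -P.δ * P.u 2 := by
    have hle : q.ptV β 0 ≤ 0 := by rw [hV0']; exact hVu.le
    rw [q.f_of_nonpos hle, q.fL_zero, q.fL_one, hV0', hV1', P.u_rec 1]
    exact ⟨by ring, rfl⟩
  have g0V : P.g 0 (q.ptV β 0) (q.ptV β 1) = 0 := by
    rw [hV0', hV1']; simp only [PolygonData.g, PolygonData.s]; ring
  have g1V : P.g 1 (q.ptV β 0) (q.ptV β 1) = 0 := by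
    rw [hV0', hV1']; simp only [PolygonData.g]; ring
  have g1fV : P.g 1 (q.f (q.ptV β) 0) (q.f (q.ptV β) 1) = 0 := by
    rw [hfV.1, hfV.2]; simp only [PolygonData.g, PolygonData.s]; ring
  have hUne : q.ptV β 1 ≠ q.f (q.ptV β) 1 := by
    rw [hV1', hfV.2]
    have := mul_nonneg P.δ_pos.le P.u_one
    have := mul_pos P.δ_pos (neg_pos.mpr hVu)
    linarith
  obtain ⟨hUline, hU1⟩ := (eq_meet_iff 1 _ _ (q.ptU β) hUne).mp rfl
  have g1U := P.g_of_mem_line 1 g1V g1fV hUline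
  have hfU : q.fInv (q.ptU β) = !₂[0, q.ptU β 0 - 1] := by
    rw [fInv, if_pos hU1.ge, hU1]; simp
  have g0fU : P.g 0 (q.fInv (q.ptU β) 0) (q.fInv (q.ptU β) 1) = 0 := by
    rw [hfU]
    have e := P.g_succ 0 0 (q.ptU β 0 - 1)
    rw [hU1] at g1U
    simp only [mul_zero, zero_add, sub_add_cancel, g1U] at e
    have := (mul_eq_zero.mp e.symm).resolve_left P.δ_pos.ne'
    simpa using this
  obtain ⟨hYU, ⟨B, hB, hB0, hB1⟩, ⟨C, hC, hC1, hC0⟩⟩ := h2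
  have g0B := P.g_of_mem_line 0 g0fU g0V hB
  have g1C := P.g_of_mem_line 1 g1V g1fV hC
  refine ⟨P, rfl, ⟨?_, ?_, ?_⟩, ?_⟩
  · rw [hY] at hYU
    rw [hfU] at hYU g0fU
    simp only [Matrix.cons_val_zero, Matrix.cons_val_one] at hYU g0fU
    rw [P.g_zero_vertical] at g0fU ⊢
    nlinarith
  · rw [← hZ0, ← hZ1]
    rw [hB0] at g0B
    have e : P.g 0 (q.ptZ β 0) (q.ptZ β 1) =
        P.g 0 (q.ptZ β 0) (B 1) + (-P.s 1) * (q.ptZ β 1 - B 1) := by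
      simp only [PolygonData.g]; ring
    rw [e, g0B, zero_add]
    exact mul_pos (by linarith) (by linarith)
  · rw [← hZ0, ← hZ1]
    rw [hC1] at g1C
    have e : P.g 1 (q.ptZ β 0) (q.ptZ β 1) =
        P.g 1 (C 0) (q.ptZ β 1) + P.δ * (-P.s 1) * (q.ptZ β 0 - C 0) := by
      simp only [PolygonData.g]; ring
    rw [e, g1C, zero_add]
    exact mul_pos (mul_pos P.δ_pos (by linarith)) (by linarith)
  · have hle := hp.le
    rw [pMax, max_le_iff] at hle
    obtain ⟨i, hi1, hi2, hi⟩ := q.exists_of_chiL_le hle.1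
    obtain ⟨j, -, hj2, hj⟩ := q.exists_of_chiL_le hle.2
    rw [hY] at hi
    rw [hZ] at hj
    exact ⟨i, j, hi1, hi2, hj2, hi, hj⟩

end

/-- If the algorithm terminates with `χ_chaos = true`, then the border-collision normal form has
a nonempty attracting set all of whose points have a positive Lyapunov exponent. -/
theorem theorem7p2 (q : BCParams) (hL : 0 < q.δL) (hR : 0 < q.δR)
    (βmin βstep βmax : ℝ) (hmin : 0 < βmin) (hstep : 0 < βstep)
    (h : q.AlgorithmOutputs βmin βstep βmax true) :
    ∃ Λ : Set Plane, IsAttractingSet q.f Λ ∧ Λ.Nonempty ∧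
      ∀ x ∈ Λ, ∃ v : Plane, ∃ lam : ℝ, 0 < lam ∧ IsLyapunovExponent q.f x v (lam : EReal) := by
  obtain ⟨s, hs, ⟨hchaos, p, hp, hcone⟩ | ⟨-, hfalse⟩⟩ := h
  swap
  · simp at hfalse
  obtain ⟨hβ, htests⟩ := q.tests_of_loopEnds hstep hs hmin (by simp)
  obtain ⟨h1, h2⟩ := htests hchaos
  obtain ⟨h3, h4, h5⟩ := q.of_coneCheck hcone
  obtain ⟨P, rfl, hP, he⟩ := q.exists_polygonData hL hR hβ h1 h2 hp h3 h5
  obtain ⟨Λ, hΛ, hne, hsub⟩ := hP.exists_attractingSet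
  exact ⟨Λ, hΛ, hne, fun x hx => hP.exists_lyapunovExponent he h3 h4 h5 (hsub hx)⟩
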